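/- Let $(W,\{s_i\}_{i\in I})$, $I\neq\emptyset$, be a simply laced Weyl group (equivalently, a finite Coxeter group in which every product $s_is_j$, $i\ne j$, has order $2$ or $3$), with length function $|\cdot|$, longest element $w_0$ and $\nu=|w_0|$. Let $K\neq\{0\}$ be a subgroup of the additive group $\mathbb R$, regarded as a semifield whose sum is $\min(a,b)$ and whose product is $a+b$; put $K_+=K\cap\mathbb R_{\ge 0}$. For a semifield $S$ let $\mathfrak U(S)$ be the monoid with generators $i^a$ ($i\in I$, $a\in S$) and the following relations, in which sums and products of exponents are those of $S$: $i^aj^b=j^bi^a$ if $i\ne j$ and $s_is_j=s_js_i$; $i^aj^bi^c=j^{a'}i^{b'}j^{c'}$ if $i\neq j$, $s_is_js_i=s_js_is_j$ and $ab=b'c'$, $a'b'=bc$, $b'=a+c$; and $i^ai^b=i^{a+b}$. Let $\mathcal U(K)\subset\mathfrak U(K)$ be the set of elements whose image in $\mathfrak U(\{1\})$ under $i^a\mapsto i^1$ is $i_1^1\cdots i_\nu^1$ for a reduced word $(i_1,\dots,i_\nu)$ of $w_0$, and let $\mathcal U(K_+)$ be the set of elements $i_1^{a_1}\cdots i_\nu^{a_\nu}$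 with $(i_1,\dots,i_\nu)$ a reduced word of $w_0$ and all $a_j\in K_+$. (a) For $i\in I$ and $a\in K$ there are well defined maps $T_i(a):\mathcal U(K)\to\mathcal U(K)$ and $z_i:\mathcal U(K)\to K$ such that, for every reduced word $(i_1,\dots,i_\nu)$ of $w_0$ with $i_1=i$ and all $a_1,\dots,a_\nu\in K$, $$T_i(a)(i_1^{a_1}i_2^{a_2}\cdots i_\nu^{a_\nu})=i_1^{a_1+a}i_2^{a_2}\cdots i_\nu^{a_\nu},\qquad z_i(i_1^{a_1}i_2^{a_2}\cdots i_\nu^{a_\nu})=a_1,$$ where $a_1+a$ is the usual sum of real numbers. Now fix a reduced word $(i_1,\dots,i_\nu)$ of $w_0$ and put $\mathbf H=i_1^0i_2^0\cdots i_\nu^0$. (b) Let $H_1\in\mathcal U(K_+)$ and define successively, for $j=1,\dots,\nu$, $c_j=z_{i_j}(H_j)$ and $H_{j+1}=T_{i_j}(-c_j)H_j$. Then $c_j\in K_+$ for $1\le j\le\nu$, $H_j\in\mathcal U(K_+)$ for $1\le j\le\nu+1$, and $$H_1=T_{i_1}(c_1)T_{i_2}(c_2)\cdots T_{i_\nu}(c_\nu)\mathbf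 H.$$ (c) The map $\mathcal U(K_+)\to K_+^\nu$, $H_1\mapsto(c_1,\dots,c_\nu)$, is injective. -/

import Mathlib

namespace HalfCircle

/-- A Coxeter matrix is simply laced if all its off-diagonal entries are `2` or `3`.
For `i ≠ j` the case `i.j = 0` (that is, `s_i s_j = s_j s_i`) is `M i j = 2`, and the case
`i.j = -1` (that is, `s_i s_j s_i = s_j s_i s_j`) is `M i j = 3`. -/
def IsSimplyLaced {I : Type*} (M : CoxeterMatrix I) : Prop :=
  ∀ i j, i ≠ j → M i j = 2 ∨ M i j = 3

/-- The defining relations between words in the symbols `i^a` (written `(i, a)`), where `i ∈ I`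
and `a` is an element of a semifield `S` (commutative, without zero). -/
inductive Rel {I : Type*} (M : CoxeterMatrix I) (S : Type*) [Mul S] [Add S] :
    FreeMonoid (I × S) → FreeMonoid (I × S) → Prop
  | comm (i j : I) (a b : S) (hij : M i j = 2) :
      Rel M S (FreeMonoid.of (i, a) * FreeMonoid.of (j, b))
        (FreeMonoid.of (j, b) * FreeMonoid.of (i, a))
  | braid (i j : I) (a b c a' b' c' : S) (hij : M i j = 3)
      (h₁ : a * b = b' * c') (h₂ : a' * b' = b * c) (h₃ : b' = a + c) :
      Rel M S (FreeMonoid.of (i, a) * FreeMonoid.of (j, b) * FreeMonoid.of (i, c))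
        (FreeMonoid.of (j, a') * FreeMonoid.of (i, b') * FreeMonoid.of (j, c'))
  | merge (i : I) (a b : S) :
      Rel M S (FreeMonoid.of (i, a) * FreeMonoid.of (i, b)) (FreeMonoid.of (i, a + b))

/-- The monoid `𝔘(S)` with generators `i^a` and the relations above. -/
abbrev UMonoid {I : Type*} (M : CoxeterMatrix I) (S : Type*) [Mul S] [Add S] : Type _ :=
  PresentedMonoid (Rel M S)

/-- The generator `i^a` of `𝔘(S)`. -/
def gen {I : Type*} (M : CoxeterMatrix I) {S : Type*} [Mul S] [Add S] (i : I) (a : S) :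
    UMonoid M S :=
  PresentedMonoid.of (Rel M S) (i, a)

/-- The element `i₁^{a₁} i₂^{a₂} ⋯ i_n^{a_n}` of `𝔘(S)` attached to the list
`(i₁, a₁), …, (i_n, a_n)`. -/
def mon {I : Type*} (M : CoxeterMatrix I) {S : Type*} [Mul S] [Add S] (L : List (I × S)) :
    UMonoid M S :=
  (L.map fun p => gen M p.1 p.2).prod

/-- The homomorphism `𝔘(S) → 𝔘({1})`, `i^a ↦ i^1`, induced by the homomorphism of semifields
from `S` to the one element semifield `{1}`. -/
def toTriv {I : Type*} (M : CoxeterMatrix I) (S : Type*) [Mul S] [Add S] :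
    UMonoid M S →* UMonoid M Unit :=
  PresentedMonoid.lift (fun p => gen M p.1 ()) (by
    intro x y h
    cases h with
    | comm i j a b hij =>
      have := PresentedMonoid.mk_eq_mk_of_rel (Rel.comm (S := Unit) i j () () hij)
      simpa [gen, PresentedMonoid.of] using this
    | braid i j a b c a' b' c' hij h₁ h₂ h₃ =>
      have := PresentedMonoid.mk_eq_mk_of_rel
        (Rel.braid (S := Unit) i j () () () () () () hij rfl rfl rfl)
      simpa [gen, PresentedMonoid.of] using this
    | merge i a b =>
      have := PresentedMonoid.mk_eq_mk_of_rel (Rel.merge (M := M) (S := Unit) i () ())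
      simpa [gen, PresentedMonoid.of] using this)

/-- The set of reduced words of `w`: sequences `i₁, …, i_n` in `I` with
`s_{i₁} ⋯ s_{i_n} = w` and `n = |w|`. -/
def redWords {I W : Type*} [Group W] {M : CoxeterMatrix I} (cs : CoxeterSystem M W) (w : W) :
    Set (List I) :=
  {ii | cs.wordProd ii = w ∧ ii.length = cs.length w}

/-- The subset `𝔘_w(S)` of `𝔘(S)`: the fibre of `𝔘(S) → 𝔘({1})` over the element
`i₁^1 ⋯ i_n^1`, where `i₁, …, i_n` is a reduced word of `w`. -/
def cell {I W : Type*} [Group W] {M : CoxeterMatrix I} (cs : CoxeterSystem M W)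
    (S : Type*) [Mul S] [Add S] (w : W) : Set (UMonoid M S) :=
  {u | ∃ ii ∈ redWords cs w, toTriv M S u = mon M (ii.map fun i => (i, ()))}

theorem mon_mem_cell {I W : Type*} [Group W] {M : CoxeterMatrix I} (cs : CoxeterSystem M W)
    {S : Type*} [Mul S] [Add S] {w : W} {L : List (I × S)}
    (hL : L.map Prod.fst ∈ redWords cs w) : mon M L ∈ cell cs S w := by
  refine ⟨_, hL, ?_⟩
  simp only [mon, map_list_prod, List.map_map]
  rfl

/-- The longest element `w₀` of the finite Coxeter group `W`. -/
noncomputable def longest {I W : Type*} [Group W] [Finite W] {M : CoxeterMatrix I}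
    (cs : CoxeterSystem M W) : W :=
  Classical.choose (Finite.exists_max cs.length)

/-- The set `𝒰(S) = 𝔘_{w₀}(S)`. -/
abbrev U {I W : Type*} [Group W] [Finite W] {M : CoxeterMatrix I} (cs : CoxeterSystem M W)
    (S : Type*) [Mul S] [Add S] : Type _ :=
  cell cs S (longest cs)

/-- The element `i₁^{a₁} ⋯ i_ν^{a_ν}` of `𝒰(S)`, where `i₁, …, i_ν` is a reduced word of `w₀`. -/
def U.mk {I W : Type*} [Group W] [Finite W] {M : CoxeterMatrix I} (cs : CoxeterSystem M W)
    {S : Type*} [Mul S] [Add S] (L : List (I × S))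
    (hL : L.map Prod.fst ∈ redWords cs (longest cs)) : U cs S :=
  ⟨mon M L, mon_mem_cell cs hL⟩

open Classical in
/-- The map `T_i(a) : 𝒰(S) → 𝒰(S)`. For a reduced word `i₁, …, i_ν` of `w₀` with `i₁ = i` it sends
`i₁^{a₁} i₂^{a₂} ⋯ i_ν^{a_ν}` to `i₁^{a₁ a} i₂^{a₂} ⋯ i_ν^{a_ν}`. -/
noncomputable def T {I W : Type*} [Group W] [Finite W] {M : CoxeterMatrix I}
    (cs : CoxeterSystem M W) {S : Type*} [Mul S] [Add S] (i : I) (a : S) (H : U cs S) : U cs S :=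
  if h : ∃ p : S × List (I × S), ∃ hp : ((i, p.1) :: p.2).map Prod.fst ∈ redWords cs (longest cs),
      U.mk cs ((i, p.1) :: p.2) hp = H
  then U.mk cs ((i, h.choose.1 * a) :: h.choose.2) h.choose_spec.choose
  else H

open Classical in
/-- The map `z_i : 𝒰(S) → S`. For a reduced word `i₁, …, i_ν` of `w₀` with `i₁ = i` it sends
`i₁^{a₁} i₂^{a₂} ⋯ i_ν^{a_ν}` to `a₁`. -/
noncomputable def z {I W : Type*} [Group W] [Finite W] {M : CoxeterMatrix I}
    (cs : CoxeterSystem M W) {S : Type*} [Mul S] [Add S] [One S] (i : I) (H : U cs S) : S :=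
  if h : ∃ p : S × List (I × S), ∃ hp : ((i, p.1) :: p.2).map Prod.fst ∈ redWords cs (longest cs),
      U.mk cs ((i, p.1) :: p.2) hp = H
  then h.choose.1
  else 1

/-- The semifield structure on a subgroup `K` of `(ℝ, +)`: the sum is `min` and the product is
`+`. In particular, the product of `a` and `b` is the usual sum, the inverse of `a` is `-a` and
the unit element is the real number `0`. -/
abbrev Trop (K : AddSubgroup ℝ) : Type := Tropical K

/-- The subset `K₊ = K ∩ ℝ_{≥ 0}`. -/
def nonneg (K : AddSubgroup ℝ) : Set (Trop K) :=
  {a | 0 ≤ ((Tropical.untrop a : K) : ℝ)}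

/-- The subset `𝒰(K₊)` of `𝒰(K)`: the elements `i₁^{a₁} ⋯ i_ν^{a_ν}` with `i₁, …, i_ν` a reduced
word of `w₀` and all `a_j` in `K₊`. -/
def Uplus {I W : Type*} [Group W] [Finite W] {M : CoxeterMatrix I} (cs : CoxeterSystem M W)
    (K : AddSubgroup ℝ) : Set (U cs (Trop K)) :=
  {H | ∃ (L : List (I × Trop K)) (hL : L.map Prod.fst ∈ redWords cs (longest cs)),
    (∀ p ∈ L, p.2 ∈ nonneg K) ∧ U.mk cs L hL = H}

/-- The element `𝐇 = i₁^0 i₂^0 ⋯ i_ν^0` of `𝒰(K)`. -/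
noncomputable def HH {I W : Type*} [Group W] [Finite W] {M : CoxeterMatrix I} (cs : CoxeterSystem M W)
    (K : AddSubgroup ℝ) (ii : List I) (hii : ii ∈ redWords cs (longest cs)) : U cs (Trop K) :=
  U.mk cs (ii.map fun i => (i, Tropical.trop (0 : K)))
    (by simpa [List.map_map, Function.comp_def] using hii)

/-- The sequence `H₁, H₂, …` (with indices shifted to start at `0`):
`H_{j+1} = T_{i_j}(-z_{i_j}(H_j)) H_j`. Here `⁻¹` in the semifield is the usual `-`. -/
noncomputable def state {I W : Type*} [Group W] [Finite W] {M : CoxeterMatrix I}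
    (cs : CoxeterSystem M W) (K : AddSubgroup ℝ) (ii : List I) (H₁ : U cs (Trop K)) (j : ℕ) :
    U cs (Trop K) :=
  (ii.take j).foldl (fun H i => T cs i (z cs i H)⁻¹ H) H₁

/-- The sequence `c₁, …, c_ν` (with indices shifted to start at `0`): `c_j = z_{i_j}(H_j)`. -/
noncomputable def coeff {I W : Type*} [Group W] [Finite W] {M : CoxeterMatrix I}
    (cs : CoxeterSystem M W) (K : AddSubgroup ℝ) (ii : List I) (H₁ : U cs (Trop K))
    (j : Fin ii.length) : Trop K :=
  z cs ii[j] (state cs K ii H₁ j)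

/-- The composition `T_{i₁}(c₁) T_{i₂}(c₂) ⋯ T_{i_ν}(c_ν)` applied to `H`. -/
noncomputable def applyT {I W : Type*} [Group W] [Finite W] {M : CoxeterMatrix I}
    (cs : CoxeterSystem M W) (K : AddSubgroup ℝ) (ii : List I) (c : Fin ii.length → Trop K)
    (H : U cs (Trop K)) : U cs (Trop K) :=
  (List.finRange ii.length).foldr (fun j X => T cs ii[j] (c j) X) H

end HalfCircle

/-! ### The tropical braid transformation -/

/-! Drop the relation $i^ai^b=i^{a+b}$ and let $B$ (`BraidMonoid`) be the monoid given by the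
remaining, length-preserving relations.

In $B$ two generators with a common right multiple have a least one, of the expected rank-two form
(`headRel_of_eq`). As for Artin monoids, this is an induction on length whose only serious step is
transitivity through a third generator. It is a check in rank three: type $A_3$ needs the
tetrahedron equation for the tropical braid transformation, and a triangle of bonds admits no common
multiple at all. Left cancellation follows.

The discarded relation is then recovered as an action. $\mathfrak U(K)$ acts on $B$, the generator
$i^a$ multiplying on the left and merging with a head $i^b$ if there is one (`demazureAction`).
Applied to $1$, a product along a reduced word returns its own class in $B$, so equal products along
reduced words are already equal in $B$. Left cancellation then makes $T_i(a)$ and $z_i$ well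
defined.

With trivial exponents, the same least common multiples let $W$ act on square-free elements, which
yields Matsumoto's theorem. Braid moves preserve nonnegativity of exponents, so an element of
$\mathcal U(K_+)$ can be written along any reduced word of $w_0$ with exponents in $K_+$.

Finally, for $a\ge 0$ one has $i^0i^a=i^{\min(0,a)}=i^0$. Resetting the first exponent $a$ of $H$ to
$0$ is therefore left multiplication by $i^0$, and the whole algorithm multiplies $H_1$ by
$i_\nu^0\cdots i_1^0=\mathbf H$. Since each generator can end a reduced word of $w_0$, $\mathbf H$
absorbs nonnegative letters on its right, so the final state is $\mathbf H$ whatever $H_1$ was.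
Undoing the steps one by one expresses $H_1$ through the $c_j$, and injectivity follows. -/

namespace HalfCircle

section

variable {G : Type*} [AddCommGroup G] [LinearOrder G]

/-- The tropical relation between the exponents of `i^a j^b i^c` and `j^{a'} i^{b'} j^{c'}`. -/
structure TropBraid (a b c a' b' c' : G) : Prop where
  mid : b' = min a c
  left : a + b = b' + c'
  right : a' + b' = b + c

theorem TropBraid.exists_eq (a b c : G) : ∃ a' b' c', TropBraid a b c a' b' c' :=
  ⟨b + c - min a c, min a c, a + b - min a c, rfl, by abel, by abel⟩

theorem TropBraid.unique {a b c x y z x' y' z' : G} (h : TropBraid a b c x y z)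
    (h' : TropBraid a b c x' y' z') : x = x' ∧ y = y' ∧ z = z' := by
  obtain ⟨h1, h2, h3⟩ := h
  obtain ⟨h1', h2', h3'⟩ := h'
  have hy : y = y' := h1.trans h1'.symm
  subst hy
  exact ⟨add_right_cancel (h3.trans h3'.symm), rfl, add_left_cancel (h2.symm.trans h2')⟩

variable [IsOrderedAddMonoid G]

theorem TropBraid.symm {a b c a' b' c' : G} (h : TropBraid a b c a' b' c') :
    TropBraid a' b' c' a b c := by
  obtain ⟨h1, h2, h3⟩ := h
  refine ⟨?_, ?_, ?_⟩ <;> grind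

theorem TropBraid.nonneg {a b c a' b' c' : G} (h : TropBraid a b c a' b' c')
    (ha : 0 ≤ a) (hb : 0 ≤ b) (hc : 0 ≤ c) : 0 ≤ a' ∧ 0 ≤ b' ∧ 0 ≤ c' := by
  obtain ⟨h1, h2, h3⟩ := h
  refine ⟨?_, ?_, ?_⟩ <;> grind

/-- The Zamolodchikov tetrahedron equation for the tropical braid transformation, in the form used
for three nodes `i - j - k` of type `A₃` when passing from a first letter `i` through `k` to `j`. -/
theorem TropBraid.tetrahedron_middle {a s t u v c p' s' t' q' u' v' b p q : G}
    (h1 : TropBraid a s t p' s' t') (h2 : TropBraid t' u v q' u' v')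
    (h3 : TropBraid c p' q' b p q)
    {c₂ s₂ u₂ : G} (h4 : TropBraid c s u c₂ s₂ u₂)
    {u₃ t₃ v₃ : G} (h5 : TropBraid u₂ t v u₃ t₃ v₃)
    {q₄ s₄ u₄ : G} (h6 : TropBraid q s' u' q₄ s₄ u₄)
    {p₅ s₅ v₅ : G} (h7 : TropBraid p s₄ v' p₅ s₅ v₅) :
    s₂ = s₅ ∧ t₃ = v₅ ∧ v₃ = u₄ ∧ TropBraid a c₂ u₃ b q₄ p₅ := by
  obtain ⟨h11, h12, h13⟩ := h1
  obtain ⟨h21, h22, h23⟩ := h2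
  obtain ⟨h31, h32, h33⟩ := h3
  obtain ⟨h41, h42, h43⟩ := h4
  obtain ⟨h51, h52, h53⟩ := h5
  obtain ⟨h61, h62, h63⟩ := h6
  obtain ⟨h71, h72, h73⟩ := h7
  have hs : s₂ = s₅ := by grind
  have ht : t₃ = v₅ := by grind
  have hv : v₃ = u₄ := by grind
  refine ⟨hs, ht, hv, ?_, ?_, ?_⟩ <;> grind

/-- The Zamolodchikov tetrahedron equation for the tropical braid transformation, in the form used
for three nodes `i - k - j` of type `A₃` when passing from a first letter `i` through `k` to `j`. -/
theorem TropBraid.tetrahedron_ends {a p q c p' q' r s b r' s' d e d' e' f g g' : G}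
    (h1 : TropBraid a p q c p' q') (h2 : TropBraid c r s b r' s')
    (h3 : TropBraid q' d e r d' e') (h4 : TropBraid s f g p' d' g')
    {q₂ e₂ g₂ : G} (h5 : TropBraid q e g' q₂ e₂ g₂)
    {p₃ d₃ q₃ : G} (h6 : TropBraid p d q₂ p₃ d₃ q₃)
    {s₄ g₄ e₄ : G} (h7 : TropBraid s' g e' s₄ g₄ e₄)
    {r₅ f₅ s₅ : G} (h8 : TropBraid r' f s₄ r₅ f₅ s₅) :
    p₃ = b ∧ r₅ = a ∧ d₃ = f₅ ∧ q₃ = g₄ ∧ e₂ = s₅ ∧ g₂ = e₄ := by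
  obtain ⟨h11, h12, h13⟩ := h1
  obtain ⟨h21, h22, h23⟩ := h2
  obtain ⟨h31, h32, h33⟩ := h3
  obtain ⟨h41, h42, h43⟩ := h4
  obtain ⟨h51, h52, h53⟩ := h5
  obtain ⟨h61, h62, h63⟩ := h6
  obtain ⟨h71, h72, h73⟩ := h7
  obtain ⟨h81, h82, h83⟩ := h8
  have hb : p₃ = b := by grind
  have ha : r₅ = a := by grind
  have hd : d₃ = f₅ := by grind
  have hq : q₃ = g₄ := by grind
  have he : e₂ = s₅ := by grind
  have hg : g₂ = e₄ := by grind
  exact ⟨hb, ha, hd, hq, he, hg⟩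

end

/-! ### The monoid of decorated words modulo braid relations -/

/-- The relations of `𝔘` between words of equal length. -/
inductive BraidRel {I : Type*} (M : CoxeterMatrix I) (G : Type*) [AddCommGroup G] [LinearOrder G] :
    FreeMonoid (I × G) → FreeMonoid (I × G) → Prop
  | comm (i j : I) (a b : G) (hij : M i j = 2) :
      BraidRel M G (FreeMonoid.of (i, a) * FreeMonoid.of (j, b))
        (FreeMonoid.of (j, b) * FreeMonoid.of (i, a))
  | braid (i j : I) (a b c a' b' c' : G) (hij : M i j = 3) (h : TropBraid a b c a' b' c') :
      BraidRel M G (FreeMonoid.of (i, a) * FreeMonoid.of (j, b) * FreeMonoid.of (i, c))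
        (FreeMonoid.of (j, a') * FreeMonoid.of (i, b') * FreeMonoid.of (j, c'))

/-- The monoid with generators `i^a` and the braid relations of `𝔘`, without `i^a i^b = i^{a+b}`. -/
abbrev BraidMonoid {I : Type*} (M : CoxeterMatrix I) (G : Type*) [AddCommGroup G] [LinearOrder G] :
    Type _ :=
  PresentedMonoid (BraidRel M G)

/-! ### Heads of elements and the inductive form of the common multiple property -/

section

variable {I : Type*} {M : CoxeterMatrix I} {G : Type*} [AddCommGroup G] [LinearOrder G]

/-- The class of a decorated word. -/
def cls (M : CoxeterMatrix I) : FreeMonoid (I × G) →* BraidMonoid M G :=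
  PresentedMonoid.mk (BraidRel M G)

/-- The generator `i^a` of the braid monoid. -/
def letter (M : CoxeterMatrix I) (i : I) (a : G) : BraidMonoid M G := cls M (FreeMonoid.of (i, a))

theorem cls_eq_of_rel {L L' : FreeMonoid (I × G)} (h : BraidRel M G L L') : cls M L = cls M L' :=
  PresentedMonoid.mk_eq_mk_of_rel h

theorem letter_comm {i j : I} (hij : M i j = 2) (a b : G) (x : BraidMonoid M G) :
    letter M i a * (letter M j b * x) = letter M j b * (letter M i a * x) := by
  have := cls_eq_of_rel (BraidRel.comm i j a b hij)
  simp only [map_mul] at this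
  simp only [letter, ← mul_assoc, this]

theorem letter_braid {i j : I} (hij : M i j = 3) {a b c a' b' c' : G}
    (h : TropBraid a b c a' b' c') (x : BraidMonoid M G) :
    letter M i a * (letter M j b * (letter M i c * x)) =
      letter M j a' * (letter M i b' * (letter M j c' * x)) := by
  have := cls_eq_of_rel (BraidRel.braid i j a b c a' b' c' hij h)
  simp only [map_mul] at this
  simp only [letter, ← mul_assoc, this]

/-- The length homomorphism of the braid monoid. -/
def lenHom (M : CoxeterMatrix I) (G : Type*) [AddCommGroup G] [LinearOrder G] :
    BraidMonoid M G →* Multiplicative ℕ :=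
  PresentedMonoid.lift (fun _ => Multiplicative.ofAdd 1) (by
    intro x y h
    cases h <;> simp)

/-- The length of an element of the braid monoid. -/
def len (x : BraidMonoid M G) : ℕ := (lenHom M G x).toAdd

@[simp] theorem len_one : len (1 : BraidMonoid M G) = 0 := rfl

@[simp] theorem len_mul (x y : BraidMonoid M G) : len (x * y) = len x + len y := by
  simp [len]

@[simp] theorem len_letter (i : I) (a : G) : len (letter M i a) = 1 := rfl

theorem letter_mul_induction {p : BraidMonoid M G → Prop} (x : BraidMonoid M G) (one : p 1)
    (mul : ∀ i a x, p x → p (letter M i a * x)) : p x := by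
  induction x using PresentedMonoid.inductionOn with
  | h L =>
    induction L using FreeMonoid.inductionOn' with
    | one => simpa using one
    | of_mul q L ih =>
      rw [map_mul]
      exact mul q.1 q.2 _ ih

/-- The ways in which `i^a x = j^b y` can arise. -/
def HeadRel (M : CoxeterMatrix I) (i : I) (a : G) (x : BraidMonoid M G) (j : I) (b : G)
    (y : BraidMonoid M G) : Prop :=
  (i = j ∧ a = b ∧ x = y) ∨
  (M i j = 2 ∧ ∃ z, x = letter M j b * z ∧ y = letter M i a * z) ∨
  (M i j = 3 ∧ ∃ p q p' q' z, TropBraid a p q b p' q' ∧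
    x = letter M j p * (letter M i q * z) ∧ y = letter M i p' * (letter M j q' * z))

/-- Any equality `i^a x = j^b y` with `x` of length less than `n` arises in one of the ways listed
in `HeadRel`. -/
def HeadRelBelow (M : CoxeterMatrix I) (G : Type*) [AddCommGroup G] [LinearOrder G] (n : ℕ) : Prop :=
  ∀ (i : I) (a : G) (x : BraidMonoid M G) (j : I) (b : G) (y : BraidMonoid M G), len x < n →
    letter M i a * x = letter M j b * y → HeadRel M i a x j b y

theorem HeadRel.eq {i j : I} {a b : G} {x y : BraidMonoid M G} (h : HeadRel M i a x j b y) :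
    letter M i a * x = letter M j b * y := by
  obtain ⟨rfl, rfl, rfl⟩ | ⟨hij, z, rfl, rfl⟩ | ⟨hij, p, q, p', q', z, ht, rfl, rfl⟩ := h
  · rfl
  · exact letter_comm hij _ _ _
  · exact letter_braid hij ht _

theorem HeadRel.mul_right {i j : I} {a b : G} {x y : BraidMonoid M G} (h : HeadRel M i a x j b y)
    (w : BraidMonoid M G) : HeadRel M i a (x * w) j b (y * w) := by
  obtain ⟨rfl, rfl, rfl⟩ | ⟨hij, z, rfl, rfl⟩ | ⟨hij, p, q, p', q', z, ht, rfl, rfl⟩ := h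
  · exact Or.inl ⟨rfl, rfl, rfl⟩
  · exact Or.inr (Or.inl ⟨hij, z * w, by simp [mul_assoc], by simp [mul_assoc]⟩)
  · exact Or.inr (Or.inr ⟨hij, p, q, p', q', z * w, ht, by simp [mul_assoc], by simp [mul_assoc]⟩)

theorem HeadRel.len_eq {i j : I} {a b : G} {x y : BraidMonoid M G} (h : HeadRel M i a x j b y) :
    len x = len y := by
  simpa using congrArg len h.eq

theorem HeadRel.symm [IsOrderedAddMonoid G] {i j : I} {a b : G} {x y : BraidMonoid M G}
    (h : HeadRel M i a x j b y) : HeadRel M j b y i a x := by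
  obtain ⟨rfl, rfl, rfl⟩ | ⟨hij, z, rfl, rfl⟩ | ⟨hij, p, q, p', q', z, ht, rfl, rfl⟩ := h
  · exact Or.inl ⟨rfl, rfl, rfl⟩
  · exact Or.inr (Or.inl ⟨by rw [M.symmetric]; exact hij, z, rfl, rfl⟩)
  · exact Or.inr (Or.inr ⟨by rw [M.symmetric]; exact hij, p', q', p, q, z, ht.symm, rfl, rfl⟩)

namespace HeadRelBelow

variable {n : ℕ}

theorem cancel (H : HeadRelBelow M G n) {i : I} {a b : G} {x y : BraidMonoid M G} (hx : len x < n)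
    (h : letter M i a * x = letter M i b * y) : a = b ∧ x = y := by
  obtain ⟨-, hab, hxy⟩ | ⟨hii, -⟩ | ⟨hii, -⟩ := H _ _ _ _ _ _ hx h
  · exact ⟨hab, hxy⟩
  · simp at hii
  · simp at hii

theorem comm (H : HeadRelBelow M G n) {i j : I} (hij : M i j = 2) {a b : G}
    {x y : BraidMonoid M G} (hx : len x < n)
    (h : letter M i a * x = letter M j b * y) :
    ∃ z, x = letter M j b * z ∧ y = letter M i a * z := by
  obtain ⟨rfl, -⟩ | ⟨-, hz⟩ | ⟨h3, -⟩ := H _ _ _ _ _ _ hx h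
  · simp at hij
  · exact hz
  · omega

theorem braid (H : HeadRelBelow M G n) {i j : I} (hij : M i j = 3) {a b : G}
    {x y : BraidMonoid M G} (hx : len x < n)
    (h : letter M i a * x = letter M j b * y) :
    ∃ p q p' q' z, TropBraid a p q b p' q' ∧
      x = letter M j p * (letter M i q * z) ∧ y = letter M i p' * (letter M j q' * z) := by
  obtain ⟨rfl, -⟩ | ⟨h2, -⟩ | ⟨-, hz⟩ := H _ _ _ _ _ _ hx h
  · simp at hij
  · omega
  · exact hz

/-- In a triangle with all bonds of order `3`, the letters `i` and the product `k j` have no common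
right multiple. -/
theorem no_common_multiple (H : HeadRelBelow M G n) : ∀ {m : ℕ} (_ : m ≤ n) {i j k : I}
    (_ : M i j = 3) (_ : M j k = 3) (_ : M i k = 3) {a b c : G} {x y : BraidMonoid M G}, len x < m →
    letter M i a * x ≠ letter M k b * (letter M j c * y) := by
  intro m
  induction m with
  | zero => intro _ _ _ _ _ _ _ _ _ _ _ _ hx; omega
  | succ m ih =>
    intro hm i j k hij hjk hik a b c x y hx h
    have hlen := congrArg len h
    simp at hlen
    obtain ⟨p, q, p', q', z, -, rfl, hz⟩ := H.braid hik (by omega) h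
    -- The tails satisfy an equation of the same shape with $(i,j,k)$ rotated to $(j,k,i)$ and a
    -- shorter left tail, so the descent never ends.
    exact ih (by omega) (i := j) (j := k) (k := i) hjk (by rw [M.symmetric]; exact hik)
      (by rw [M.symmetric]; exact hij) (by simp at hx hlen; omega) hz

end HeadRelBelow

end

/-! ### Transitivity in rank three and existence of least common multiples -/

section

variable {I : Type*} {M : CoxeterMatrix I} {G : Type*} [AddCommGroup G] [LinearOrder G]

namespace HeadRel

variable {n : ℕ} {i j k : I} {a b c : G} {x y v : BraidMonoid M G}

/-- Here $k$ commutes with $i$ and $j$: the two factorizations of $v$ are related by induction, and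
$k^c$ is moved past the result. -/
theorem trans_two_two (hM : IsSimplyLaced M) (H : HeadRelBelow M G n) (hv : len v ≤ n)
    (hik : M i k = 2) (hkj : M k j = 2) (hij : i ≠ j)
    {z z' : BraidMonoid M G} (hx : x = letter M k c * z) (hz : v = letter M i a * z)
    (hz' : v = letter M j b * z') (hy : y = letter M k c * z') : HeadRel M i a x j b y := by
  have hki : M k i = 2 := by rw [M.symmetric]; exact hik
  subst hx hy hz
  simp only [len_mul, len_letter] at hv
  rcases hM i j hij with h | h
  · obtain ⟨w, rfl, rfl⟩ := H.comm h (by omega) hz'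
    exact Or.inr (Or.inl ⟨h, letter M k c * w, letter_comm hkj _ _ _,
      letter_comm hki _ _ _⟩)
  · obtain ⟨p, q, p', q', w, ht, rfl, rfl⟩ := H.braid h (by omega) hz'
    refine Or.inr (Or.inr ⟨h, p, q, p', q', letter M k c * w, ht, ?_, ?_⟩)
    · rw [letter_comm hkj, letter_comm hki]
    · rw [letter_comm hki, letter_comm hkj]

variable [IsOrderedAddMonoid G]

/-- Type $A_1\times A_2$ if $i$ and $j$ commute, otherwise the chain $i-j-k$ of type $A_3$. In the
chain, repeated use of the induction hypothesis exposes a six-letter word, a longest word of $A_3$,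
in front of a common remainder. Rewriting it along both routes gives the same exponents by
`TropBraid.tetrahedron_middle`. -/
theorem trans_two_three (hM : IsSimplyLaced M) (H : HeadRelBelow M G n) (hv : len v ≤ n)
    (hik : M i k = 2) (hkj : M k j = 3) (hij : i ≠ j)
    {z z' : BraidMonoid M G} {p q p' q' : G} (h3 : TropBraid c p' q' b p q)
    (hx : x = letter M k c * z) (hz : v = letter M i a * z)
    (hz' : v = letter M j p' * (letter M k q' * z'))
    (hy : y = letter M k p * (letter M j q * z')) : HeadRel M i a x j b y := by
  have hki : M k i = 2 := by rw [M.symmetric]; exact hik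
  have hjk : M j k = 3 := by rw [M.symmetric]; exact hkj
  subst hx hy hz
  have hlen := congrArg len hz'
  simp only [len_mul, len_letter] at hv hlen
  rcases hM i j hij with h | h
  · obtain ⟨w, rfl, hw⟩ := H.comm h (by omega) hz'
    obtain ⟨w', rfl, rfl⟩ := H.comm hki (by simp at hlen hv ⊢; omega) hw
    refine Or.inr (Or.inl ⟨h, letter M k p * (letter M j q * w'), letter_braid hkj h3 _, ?_⟩)
    rw [letter_comm (i := j) (j := i) (by rw [M.symmetric]; exact h), letter_comm hki]
  · have hji : M j i = 3 := by rw [M.symmetric]; exact h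
    obtain ⟨s, t, s', t', w, h1, rfl, hw⟩ := H.braid h (by omega) hz'
    obtain ⟨w₂, rfl, hw₂⟩ := H.comm hki (by simp at hlen hv ⊢; omega) hw
    have hlen₂ := congrArg len hw₂
    obtain ⟨u, v, u', v', w₃, h2, rfl, rfl⟩ :=
      H.braid hjk (by simp at hlen hv hlen₂ ⊢; omega) hw₂
    obtain ⟨c₂, s₂, u₂, h4⟩ := TropBraid.exists_eq c s u
    obtain ⟨u₃, t₃, v₃, h5⟩ := TropBraid.exists_eq u₂ t v
    obtain ⟨q₄, s₄, u₄, h6⟩ := TropBraid.exists_eq q s' u'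
    obtain ⟨p₅, s₅, v₅, h7⟩ := TropBraid.exists_eq p s₄ v'
    obtain ⟨rfl, rfl, rfl, h8⟩ := TropBraid.tetrahedron_middle h1 h2 h3 h4 h5 h6 h7
    refine Or.inr (Or.inr ⟨h, c₂, u₃, q₄, p₅,
      letter M k s₂ * (letter M j t₃ * (letter M i v₃ * w₃)), h8, ?_, ?_⟩)
    · rw [letter_comm hik, letter_braid hkj h4, letter_braid hji h5, letter_comm hki]
    · rw [letter_braid hji h6, letter_comm hki, letter_comm hik v₃, letter_braid hkj h7]

/-- The chain $i-k-j$ of type $A_3$ if $i$ and $j$ commute, settled by `TropBraid.tetrahedron_ends`.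
Otherwise the three nodes form a triangle, which `no_common_multiple` excludes. -/
theorem trans_three_three (hM : IsSimplyLaced M) (H : HeadRelBelow M G n) (hv : len v ≤ n)
    (hik : M i k = 3) (hkj : M k j = 3) (hij : i ≠ j)
    {z z' : BraidMonoid M G} {p q p' q' r s r' s' : G} (h1 : TropBraid a p q c p' q')
    (h2 : TropBraid c r s b r' s')
    (hx : x = letter M k p * (letter M i q * z)) (hz : v = letter M i p' * (letter M k q' * z))
    (hz' : v = letter M j r * (letter M k s * z'))
    (hy : y = letter M k r' * (letter M j s' * z')) : HeadRel M i a x j b y := by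
  have hki : M k i = 3 := by rw [M.symmetric]; exact hik
  have hjk : M j k = 3 := by rw [M.symmetric]; exact hkj
  subst hx hy hz
  have hlen := congrArg len hz'
  simp only [len_mul, len_letter] at hv hlen
  rcases hM i j hij with h | h
  · have hji : M j i = 2 := by rw [M.symmetric]; exact h
    obtain ⟨w, hw, hw'⟩ := H.comm h (by simp; omega) hz'
    obtain ⟨d, e, d', e', w₁, h3, rfl, rfl⟩ := H.braid hkj (by omega) hw
    obtain ⟨f, g, f', g', w₂, h4, rfl, hw₂⟩ := H.braid hki (by omega) hw'
    obtain ⟨rfl, hw₃⟩ := H.cancel (by simp at hlen hv ⊢; omega) hw₂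
    obtain ⟨w₃, rfl, rfl⟩ := H.comm hji (by simp at hlen hv ⊢; omega) hw₃
    obtain ⟨q₂, e₂, g₂, h5⟩ := TropBraid.exists_eq q e g'
    obtain ⟨p₃, d₃, q₃, h6⟩ := TropBraid.exists_eq p d q₂
    obtain ⟨s₄, g₄, e₄, h7⟩ := TropBraid.exists_eq s' g e'
    obtain ⟨r₅, f₅, s₅, h8⟩ := TropBraid.exists_eq r' f s₄
    obtain ⟨rfl, rfl, rfl, rfl, rfl, rfl⟩ := TropBraid.tetrahedron_ends h1 h2 h3 h4 h5 h6 h7 h8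
    refine Or.inr (Or.inl ⟨h,
      letter M k d₃ * (letter M j q₃ * (letter M i e₂ * (letter M k g₂ * w₃))), ?_, ?_⟩)
    · rw [letter_comm h, letter_braid hik h5, letter_braid hkj h6]
    · rw [letter_comm hji, letter_braid hjk h7, letter_braid hki h8, letter_comm h]
  · exact absurd hz' (H.no_common_multiple le_rfl (i := i) (j := k) (k := j) hik hkj h
      (by simp; omega))

/-- The heart of the induction. Unless one of the two relations is trivial, they factor $v$ in two
ways with tails of length below $n$, to which the induction hypothesis applies. -/
theorem trans (hM : IsSimplyLaced M) (H : HeadRelBelow M G n) (hv : len v ≤ n)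
    (h₁ : HeadRel M i a x k c v) (h₂ : HeadRel M k c v j b y) : HeadRel M i a x j b y := by
  have h₁' := h₁
  have h₂' := h₂
  have hlen := h₁.len_eq
  obtain ⟨rfl, rfl, rfl⟩ | ⟨hik, z, hx, hz⟩ | ⟨hik, p, q, p', q', z, h1, hx, hz⟩ := h₁
  · exact h₂
  · obtain ⟨rfl, rfl, rfl⟩ | ⟨hkj, z', hz', hy⟩ | ⟨hkj, r, s, r', s', z', h2, hz', hy⟩ := h₂
    · exact h₁'
    · by_cases hij : i = j
      · subst hij
        obtain ⟨rfl, rfl⟩ := H.cancel (by subst hz; simp at hv; omega) (hz.symm.trans hz')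
        exact Or.inl ⟨rfl, rfl, hx.trans hy.symm⟩
      · exact trans_two_two hM H hv hik hkj hij hx hz hz' hy
    · by_cases hij : i = j
      · subst hij
        rw [M.symmetric] at hkj
        omega
      · exact trans_two_three hM H hv hik hkj hij h2 hx hz hz' hy
  · obtain ⟨rfl, rfl, rfl⟩ | ⟨hkj, z', hz', hy⟩ | ⟨hkj, r, s, r', s', z', h2, hz', hy⟩ := h₂
    · exact h₁'
    · by_cases hij : i = j
      · subst hij
        rw [M.symmetric] at hkj
        omega
      · exact (trans_two_three hM H hv (by rw [M.symmetric]; exact hkj)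
          (by rw [M.symmetric]; exact hik) (Ne.symm hij) h1.symm hy hz' hz hx).symm
    · by_cases hij : i = j
      · subst hij
        obtain ⟨rfl, hz₂⟩ := H.cancel (by subst hz; simp at hv ⊢; omega) (hz.symm.trans hz')
        obtain ⟨rfl, rfl⟩ := H.cancel (by subst hz; simp at hv ⊢; omega) hz₂
        -- A braid move from $i$ to $k$ followed by one back to $i$ is the identity, the tropical
        -- transformation being its own inverse.
        obtain ⟨rfl, rfl, rfl⟩ := h1.symm.unique h2
        exact Or.inl ⟨rfl, rfl, hx.trans hy.symm⟩
      · exact trans_three_three hM H hv hik hkj hij h1 h2 hx hz hz' hy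

end HeadRel

variable [IsOrderedAddMonoid G]

/-- `HeadRel`, for the heads and tails of two words. -/
def WordHeadRel (M : CoxeterMatrix I) : List (I × G) → List (I × G) → Prop
  | [], [] => True
  | p :: L, q :: L' => HeadRel M p.1 p.2 (cls M (FreeMonoid.ofList L)) q.1 q.2
      (cls M (FreeMonoid.ofList L'))
  | _, _ => False

/-- Induction over the generation of the congruence, with `HeadRel.trans` at the transitivity step.
The bound is $n+1$ because the head letter is counted in the length of the word. -/
theorem wordHeadRel_of_conGen (hM : IsSimplyLaced M) {n : ℕ} (H : HeadRelBelow M G n)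
    {L L' : FreeMonoid (I × G)} (h : ConGen.Rel (BraidRel M G) L L') :
    len (cls M L) ≤ n + 1 → WordHeadRel M L.toList L'.toList := by
  have cls_eq : ∀ {L L' : FreeMonoid (I × G)}, ConGen.Rel (BraidRel M G) L L' →
      cls M L = cls M L' := fun h => (Con.eq _).2 h
  induction h with
  | of L L' h =>
    intro _
    cases h with
    | comm i j a b hij =>
      exact Or.inr (Or.inl ⟨hij, 1, by simp [letter, FreeMonoid.ofList_cons],
        by simp [letter, FreeMonoid.ofList_cons]⟩)
    | braid i j a b c a' b' c' hij h =>
      exact Or.inr (Or.inr ⟨hij, b, c, b', c', 1, h, by simp [letter, FreeMonoid.ofList_cons],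
        by simp [letter, FreeMonoid.ofList_cons]⟩)
  | refl L =>
    intro _
    rcases L.toList with _ | ⟨p, L⟩
    · trivial
    · exact Or.inl ⟨rfl, rfl, rfl⟩
  | @symm L L' h ih =>
    intro hl
    have := ih (by rwa [cls_eq h])
    revert this
    rcases L.toList with _ | ⟨p, L⟩ <;> rcases L'.toList with _ | ⟨p', L'⟩ <;>
      simp only [WordHeadRel, imp_self]
    exact HeadRel.symm
  | @trans L L' L'' h h' ih ih' =>
    intro hl
    have h₁ := ih hl
    have hl' : len (cls M L') ≤ n + 1 := by rwa [← cls_eq h]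
    have h₂ := ih' hl'
    rw [← FreeMonoid.ofList_toList L'] at hl'
    revert h₁ h₂ hl'
    rcases L.toList with _ | ⟨p, L⟩ <;> rcases L'.toList with _ | ⟨p', L'⟩ <;>
      rcases L''.toList with _ | ⟨p'', L''⟩ <;>
      simp only [WordHeadRel, imp_self, implies_true, false_implies]
    intro h₁ hl' h₂
    refine HeadRel.trans hM H ?_ h₁ h₂
    rw [FreeMonoid.ofList_cons, map_mul, len_mul] at hl'
    change 1 + _ ≤ _ at hl'
    omega
  -- The head of a product is that of its first factor, unless this is empty; then the second factor
  -- decides.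
  | @mul L₁ L₁' L₂ L₂' h₁ h₂ ih₁ ih₂ =>
    intro hl
    rw [map_mul, len_mul] at hl
    have hw₁ := ih₁ (by omega)
    have hw₂ := ih₂ (by omega)
    have heq := cls_eq h₂
    rw [FreeMonoid.toList_mul, FreeMonoid.toList_mul]
    revert hw₁
    rcases L₁.toList with _ | ⟨p, L₁⟩ <;> rcases L₁'.toList with _ | ⟨p', L₁'⟩ <;>
      simp only [WordHeadRel, false_implies, List.nil_append, List.cons_append]
    · exact fun _ => hw₂
    · intro hw₁
      simp only [FreeMonoid.ofList_append, FreeMonoid.ofList_toList, map_mul, ← heq]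
      exact hw₁.mul_right _

/-- In the braid monoid of a simply laced Coxeter matrix, with decorations subject to the tropical
braid transformation, two generators with a common right multiple have a least one. -/
theorem headRel_of_eq (hM : IsSimplyLaced M) {i j : I} {a b : G} {x y : BraidMonoid M G}
    (h : letter M i a * x = letter M j b * y) : HeadRel M i a x j b y := by
  have key : ∀ n, HeadRelBelow M G n := by
    intro n
    induction n with
    | zero => intro i a x j b y hx; omega
    | succ n ih =>
      intro i a x j b y hx h
      induction x using PresentedMonoid.inductionOn with | h L => ?_
      induction y using PresentedMonoid.inductionOn with | h L' => ?_
      have h' : ConGen.Rel (BraidRel M G) (FreeMonoid.of (i, a) * L) (FreeMonoid.of (j, b) * L') :=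
        (Con.eq _).1 h
      refine wordHeadRel_of_conGen hM ih h' ?_
      rw [map_mul, len_mul]
      change 1 + len (cls M L) ≤ n + 1
      change len (cls M L) < n + 1 at hx
      omega
  exact key (len x + 1) i a x j b y (by omega) h

section

variable {i j : I} {a b : G} {x y : BraidMonoid M G}

theorem letter_mul_cancel (hM : IsSimplyLaced M) (h : letter M i a * x = letter M i b * y) :
    a = b ∧ x = y :=
  HeadRelBelow.cancel (n := len x + 1) (fun _ _ _ _ _ _ _ => headRel_of_eq hM) (by omega) h

theorem exists_of_comm (hM : IsSimplyLaced M) (hij : M i j = 2)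
    (h : letter M i a * x = letter M j b * y) :
    ∃ z, x = letter M j b * z ∧ y = letter M i a * z :=
  HeadRelBelow.comm (n := len x + 1) (fun _ _ _ _ _ _ _ => headRel_of_eq hM) hij (by omega) h

theorem exists_of_braid (hM : IsSimplyLaced M) (hij : M i j = 3)
    (h : letter M i a * x = letter M j b * y) :
    ∃ p q p' q' z, TropBraid a p q b p' q' ∧
      x = letter M j p * (letter M i q * z) ∧ y = letter M i p' * (letter M j q' * z) :=
  HeadRelBelow.braid (n := len x + 1) (fun _ _ _ _ _ _ _ => headRel_of_eq hM) hij (by omega) h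

end

end

/-! ### The action of $\mathfrak U$ on the braid monoid -/

section

variable {I : Type*} {M : CoxeterMatrix I} {G : Type*} [AddCommGroup G] [LinearOrder G]

/-- `x` is left divisible by a power of the generator `i`. -/
def HasHead (i : I) (x : BraidMonoid M G) : Prop := ∃ a y, x = letter M i a * y

theorem hasHead_letter_mul (i : I) (a : G) (y : BraidMonoid M G) : HasHead i (letter M i a * y) :=
  ⟨a, y, rfl⟩

open Classical in
/-- The operator `x ↦ i^a x` modulo `i^a i^b = i^{min(a, b)}`. -/
noncomputable def demazure (i : I) (a : G) (x : BraidMonoid M G) : BraidMonoid M G :=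
  if h : ∃ p : G × BraidMonoid M G, x = letter M i p.1 * p.2
  then letter M i (min a h.choose.1) * h.choose.2 else letter M i a * x

theorem demazure_of_not_hasHead {i : I} {x : BraidMonoid M G} (h : ¬ HasHead i x) (a : G) :
    demazure i a x = letter M i a * x :=
  dif_neg fun ⟨p, hp⟩ => h ⟨p.1, p.2, hp⟩

theorem tropBraid_untrop {a b c a' b' c' : Tropical G} (h₁ : a * b = b' * c')
    (h₂ : a' * b' = b * c) (h₃ : b' = a + c) :
    TropBraid a.untrop b.untrop c.untrop a'.untrop b'.untrop c'.untrop := by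
  refine ⟨?_, ?_, ?_⟩
  · rw [h₃, Tropical.untrop_add]
  · rw [← Tropical.untrop_mul, h₁, Tropical.untrop_mul]
  · rw [← Tropical.untrop_mul, h₂, Tropical.untrop_mul]

/-- The quotient map from the braid monoid to `𝔘`. -/
def toUMonoid (M : CoxeterMatrix I) (G : Type*) [AddCommGroup G] [LinearOrder G] :
    BraidMonoid M G →* UMonoid M (Tropical G) :=
  PresentedMonoid.lift (fun p => gen M p.1 (Tropical.trop p.2)) (by
    intro x y h
    cases h with
    | comm i j a b hij =>
      exact PresentedMonoid.mk_eq_mk_of_rel (Rel.comm i j _ _ hij)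
    | braid i j a b c a' b' c' hij h =>
      exact PresentedMonoid.mk_eq_mk_of_rel (Rel.braid i j _ _ _ _ _ _ hij
        (congrArg Tropical.trop h.left) (congrArg Tropical.trop h.right)
        (congrArg Tropical.trop h.mid)))

/-- The class in the braid monoid of a word with tropical exponents. -/
def tropCls (M : CoxeterMatrix I) (L : List (I × Tropical G)) : BraidMonoid M G :=
  (L.map fun p => letter M p.1 p.2.untrop).prod

theorem tropCls_cons (i : I) (a : Tropical G) (L : List (I × Tropical G)) :
    tropCls M ((i, a) :: L) = letter M i a.untrop * tropCls M L := by
  simp [tropCls]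

theorem mon_cons {S : Type*} [Mul S] [Add S] (i : I) (a : S) (L : List (I × S)) :
    mon M ((i, a) :: L) = gen M i a * mon M L := by
  simp [mon]

theorem toUMonoid_tropCls (L : List (I × Tropical G)) :
    toUMonoid M G (tropCls M L) = mon M L := by
  rw [tropCls, mon, map_list_prod, List.map_map]
  rfl

variable [IsOrderedAddMonoid G]

/-- By left cancellation the factorization chosen in `demazure` is the only one. -/
theorem demazure_letter_mul (hM : IsSimplyLaced M) (i : I) (a b : G) (y : BraidMonoid M G) :
    demazure i a (letter M i b * y) = letter M i (min a b) * y := by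
  have h : ∃ p : G × BraidMonoid M G, letter M i b * y = letter M i p.1 * p.2 := ⟨(b, y), rfl⟩
  obtain ⟨h₁, h₂⟩ := letter_mul_cancel hM h.choose_spec
  rw [demazure, dif_pos h, ← h₁, ← h₂]

theorem HasHead.of_letter_mul_of_comm (hM : IsSimplyLaced M) {i j : I} (hij : M i j = 2) {a : G}
    {x : BraidMonoid M G} (h : HasHead j (letter M i a * x)) : HasHead j x := by
  obtain ⟨b, y, h⟩ := h
  obtain ⟨z, rfl, -⟩ := exists_of_comm hM hij h
  exact hasHead_letter_mul _ _ _

theorem HasHead.of_letter_mul_of_braid (hM : IsSimplyLaced M) {i j : I} (hij : M i j = 3) {a : G}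
    {x : BraidMonoid M G} (h : HasHead j (letter M i a * x)) : HasHead j x := by
  obtain ⟨b, y, h⟩ := h
  obtain ⟨p, q, p', q', z, -, rfl, -⟩ := exists_of_braid hM hij h
  exact hasHead_letter_mul _ _ _

theorem HasHead.of_letter_mul_letter_mul (hM : IsSimplyLaced M) {i j : I} (hij : M i j = 3)
    {a b : G} {x : BraidMonoid M G} (h : HasHead i (letter M j a * (letter M i b * x))) :
    HasHead j x := by
  obtain ⟨c, y, h⟩ := h
  obtain ⟨p, q, p', q', z, -, hz, -⟩ := exists_of_braid hM (by rw [M.symmetric]; exact hij) h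
  obtain ⟨-, rfl⟩ := letter_mul_cancel hM hz
  exact hasHead_letter_mul _ _ _

/-- The position of `x` with respect to the generators `i` and `j`, with the cases in which `j` but
not `i` is a head and those in which both are. -/
inductive RankTwo (i j : I) (x : BraidMonoid M G) : Prop
  | none (hi : ¬ HasHead i x) (hj : ¬ HasHead j x)
  | one (b : G) (y : BraidMonoid M G) (hx : x = letter M j b * y) (hi : ¬ HasHead i x)
      (hy : ¬ HasHead i y)
  | two (b c : G) (y : BraidMonoid M G) (hx : x = letter M j b * (letter M i c * y))
      (hi : ¬ HasHead i x) (hy : ¬ HasHead j y)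
  | three (a b c : G) (y : BraidMonoid M G)
      (hx : x = letter M i a * (letter M j b * (letter M i c * y)))

/-- Strips off letters $i$ and $j$ from the left in alternation. If both are heads, the least common
multiple supplies all three letters at once. -/
theorem rankTwo_or (hM : IsSimplyLaced M) {i j : I} (hij : M i j = 3) (x : BraidMonoid M G) :
    RankTwo i j x ∨ RankTwo j i x := by
  have key : ∀ {i j : I}, M i j = 3 → HasHead j x → ¬ HasHead i x → RankTwo i j x := by
    rintro i j hij ⟨b, y, hx⟩ hi
    by_cases hy : HasHead i y
    · obtain ⟨c, y, rfl⟩ := hy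
      refine .two b c y hx hi ?_
      -- A further head $j$ would let $j\,i\,j$ turn into $i\,j\,i$, making $i$ a head of $x$.
      rintro ⟨d, z, rfl⟩
      obtain ⟨_, _, _, ht⟩ := TropBraid.exists_eq b c d
      rw [letter_braid (by rw [M.symmetric]; exact hij) ht] at hx
      exact hi ⟨_, _, hx⟩
    · exact .one b y hx hi hy
  by_cases hi : HasHead i x <;> by_cases hj : HasHead j x
  · obtain ⟨a, y, rfl⟩ := hi
    obtain ⟨b, y', h⟩ := hj
    obtain ⟨p, q, p', q', z, -, rfl, -⟩ := exists_of_braid hM hij h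
    exact Or.inl (.three _ _ _ _ rfl)
  · exact Or.inr (key (by rw [M.symmetric]; exact hij) hi hj)
  · exact Or.inl (key hij hj hi)
  · exact Or.inl (.none hi hj)

theorem demazure_merge (hM : IsSimplyLaced M) (i : I) (a b : G) (x : BraidMonoid M G) :
    demazure i a (demazure i b x) = demazure i (min a b) x := by
  by_cases h : HasHead i x
  · obtain ⟨c, y, rfl⟩ := h
    simp only [demazure_letter_mul hM, min_assoc]
  · rw [demazure_of_not_hasHead h, demazure_of_not_hasHead h, demazure_letter_mul hM]

theorem demazure_comm (hM : IsSimplyLaced M) {i j : I} (hij : M i j = 2) (a b : G)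
    (x : BraidMonoid M G) : demazure i a (demazure j b x) = demazure j b (demazure i a x) := by
  have hji : M j i = 2 := by rw [M.symmetric]; exact hij
  have key : ∀ {i j : I} (a b : G), M i j = 2 → ¬ HasHead i x →
      demazure i a (demazure j b x) = demazure j b (demazure i a x) := by
    intro i j a b hij hi
    have hji : M j i = 2 := by rw [M.symmetric]; exact hij
    rw [demazure_of_not_hasHead hi]
    by_cases hj : HasHead j x
    · obtain ⟨c, y, rfl⟩ := hj
      have hy : ∀ c, ¬ HasHead i (letter M j c * y) := by
        rintro c' hc
        obtain ⟨d, z, rfl⟩ := hc.of_letter_mul_of_comm hM hji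
        exact hi ⟨_, _, letter_comm hji _ _ _⟩
      rw [demazure_letter_mul hM, demazure_of_not_hasHead (hy _), letter_comm hij a c,
        demazure_letter_mul hM, letter_comm hij]
    · rw [demazure_of_not_hasHead hj,
        demazure_of_not_hasHead fun h => hi (h.of_letter_mul_of_comm hM hji),
        demazure_of_not_hasHead fun h => hj (h.of_letter_mul_of_comm hM hij), letter_comm hij]
  by_cases hi : HasHead i x
  · by_cases hj : HasHead j x
    · obtain ⟨c, y, rfl⟩ := hi
      obtain ⟨d, y', h⟩ := hj
      obtain ⟨z, rfl, -⟩ := exists_of_comm hM hij h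
      rw [demazure_letter_mul hM, letter_comm hij, demazure_letter_mul hM, letter_comm hij,
        demazure_letter_mul hM, letter_comm hji, demazure_letter_mul hM, letter_comm hij]
    · exact (key b a hji hj).symm
  · exact key a b hij hi

/-- In each case the absent heads say when an operator simply multiplies, and braid moves bring the
letter to be merged to the front. Both sides become three letters in $i,j$ before the same element,
and what remains is an identity between sums and minima of exponents. -/
theorem demazure_braid_of_rankTwo (hM : IsSimplyLaced M) {i j : I} (hij : M i j = 3)
    {a b c a' b' c' : G} (h : TropBraid a b c a' b' c') {x : BraidMonoid M G}
    (hx : RankTwo i j x) : demazure i a (demazure j b (demazure i c x)) =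
      demazure j a' (demazure i b' (demazure j c' x)) := by
  have hji : M j i = 3 := by rw [M.symmetric]; exact hij
  cases hx with
  | none hi hj =>
    rw [demazure_of_not_hasHead hi,
      demazure_of_not_hasHead fun h => hj (h.of_letter_mul_of_braid hM hij),
      demazure_of_not_hasHead fun h => hj (h.of_letter_mul_letter_mul hM hij),
      demazure_of_not_hasHead hj,
      demazure_of_not_hasHead fun h => hi (h.of_letter_mul_of_braid hM hji),
      demazure_of_not_hasHead fun h => hi (h.of_letter_mul_letter_mul hM hji),
      letter_braid hij h]
  | one d y hx hi hy =>
    subst hx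
    obtain ⟨b₁, c₁, d₁, ht⟩ := TropBraid.exists_eq b c d
    rw [demazure_of_not_hasHead hi,
      demazure_of_not_hasHead fun h => hy (h.of_letter_mul_letter_mul hM hji),
      letter_braid hji ht, demazure_letter_mul hM, demazure_letter_mul hM,
      demazure_of_not_hasHead fun h => hy (h.of_letter_mul_of_braid hM hji),
      demazure_of_not_hasHead fun h => hy (h.of_letter_mul_letter_mul hM hji)]
    refine letter_braid hij ?_ _
    obtain ⟨h1, h2, h3⟩ := h
    obtain ⟨h1', h2', h3'⟩ := ht
    refine ⟨?_, ?_, ?_⟩ <;> grind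
  | two d e y hx hi hy =>
    subst hx
    obtain ⟨c₁, d₁, e₁, ht⟩ := TropBraid.exists_eq c d e
    obtain ⟨c₂, d₂, e₂, ht₂⟩ := TropBraid.exists_eq (min b c₁) d₁ e₁
    obtain ⟨f₁, g₁, h₁, ht₃⟩ := TropBraid.exists_eq b' (min c' d) e
    rw [demazure_of_not_hasHead hi, letter_braid hij ht, demazure_letter_mul hM,
      letter_braid hji ht₂, demazure_letter_mul hM, demazure_letter_mul hM,
      demazure_of_not_hasHead fun h => hy (h.of_letter_mul_letter_mul hM hij),
      letter_braid hij ht₃, demazure_letter_mul hM]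
    refine letter_braid hij ?_ _
    obtain ⟨h1, h2, h3⟩ := h
    obtain ⟨h1', h2', h3'⟩ := ht
    obtain ⟨h4, h5, h6⟩ := ht₂
    obtain ⟨h4', h5', h6'⟩ := ht₃
    refine ⟨?_, ?_, ?_⟩ <;> grind
  | three d e f y hx =>
    subst hx
    obtain ⟨d₁, e₁, f₁, h₁⟩ := TropBraid.exists_eq (min c d) e f
    obtain ⟨d₂, e₂, f₂, h₂⟩ := TropBraid.exists_eq (min b d₁) e₁ f₁
    obtain ⟨d₃, e₃, f₃, h₃⟩ := TropBraid.exists_eq d e f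
    obtain ⟨d₄, e₄, f₄, h₄⟩ := TropBraid.exists_eq (min c' d₃) e₃ f₃
    obtain ⟨d₅, e₅, f₅, h₅⟩ := TropBraid.exists_eq (min b' d₄) e₄ f₄
    rw [demazure_letter_mul hM, letter_braid hij h₁, demazure_letter_mul hM, letter_braid hji h₂,
      demazure_letter_mul hM, letter_braid hij h₃, demazure_letter_mul hM, letter_braid hji h₄,
      demazure_letter_mul hM, letter_braid hij h₅, demazure_letter_mul hM]
    refine letter_braid hij ?_ _
    obtain ⟨h01, h02, h03⟩ := h
    obtain ⟨h11, h12, h13⟩ := h₁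
    obtain ⟨h21, h22, h23⟩ := h₂
    obtain ⟨h31, h32, h33⟩ := h₃
    obtain ⟨h41, h42, h43⟩ := h₄
    obtain ⟨h51, h52, h53⟩ := h₅
    refine ⟨?_, ?_, ?_⟩ <;> grind

theorem demazure_braid (hM : IsSimplyLaced M) {i j : I} (hij : M i j = 3)
    {a b c a' b' c' : G} (h : TropBraid a b c a' b' c') (x : BraidMonoid M G) :
    demazure i a (demazure j b (demazure i c x)) =
      demazure j a' (demazure i b' (demazure j c' x)) := by
  rcases rankTwo_or hM hij x with hx | hx
  · exact demazure_braid_of_rankTwo hM hij h hx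
  · exact (demazure_braid_of_rankTwo hM (by rw [M.symmetric]; exact hij) h.symm hx).symm

/-- The operator `demazure` as an element of the monoid of maps from the braid monoid to itself. -/
noncomputable def demazureEnd (p : I × Tropical G) : Function.End (BraidMonoid M G) :=
  demazure p.1 p.2.untrop

/-- The action of `𝔘` on the braid monoid by the operators `demazure`. -/
noncomputable def demazureAction (hM : IsSimplyLaced M) (G : Type*) [AddCommGroup G]
    [LinearOrder G] [IsOrderedAddMonoid G] :
    UMonoid M (Tropical G) →* Function.End (BraidMonoid M G) :=
  PresentedMonoid.lift demazureEnd (by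
    intro x y (h : Rel M (Tropical G) x y)
    funext w
    cases h with
    | comm i j a b hij =>
      simp only [map_mul, FreeMonoid.lift_eval_of]
      exact demazure_comm hM hij _ _ _
    | braid i j a b c a' b' c' hij h₁ h₂ h₃ =>
      simp only [map_mul, FreeMonoid.lift_eval_of]
      exact demazure_braid hM hij (tropBraid_untrop h₁ h₂ h₃) _
    | merge i a b =>
      simp only [map_mul, FreeMonoid.lift_eval_of]
      exact demazure_merge hM _ _ _ _)

theorem demazureAction_gen_mul (hM : IsSimplyLaced M) (i : I) (a : Tropical G)
    (u : UMonoid M (Tropical G)) (x : BraidMonoid M G) :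
    demazureAction hM G (gen M i a * u) x = demazure i a.untrop (demazureAction hM G u x) := by
  rw [map_mul]
  rfl

end

/-! ### Reduced elements and uniqueness of exponents -/

section Coxeter

variable {I W : Type*} [Group W] {M : CoxeterMatrix I} (cs : CoxeterSystem M W) {G : Type*}
  [AddCommGroup G] [LinearOrder G]

theorem simple_mul_comm {i j : I} (hij : M i j = 2) :
    cs.simple i * cs.simple j = cs.simple j * cs.simple i := by
  have h := cs.simple_mul_simple_pow i j
  rw [hij, pow_two] at h
  have h2 := eq_inv_of_mul_eq_one_left h
  simpa using h2

theorem simple_braid {i j : I} (hij : M i j = 3) :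
    cs.simple i * cs.simple j * cs.simple i = cs.simple j * cs.simple i * cs.simple j := by
  have h := cs.simple_mul_simple_pow i j
  rw [hij, pow_succ, pow_two] at h
  have h2 : (cs.simple i * cs.simple j * cs.simple i) *
      (cs.simple j * cs.simple i * cs.simple j) = 1 := by
    simpa only [mul_assoc] using h
  have h3 := eq_inv_of_mul_eq_one_left h2
  simpa [mul_assoc] using h3

/-- The projection from the braid monoid to the Coxeter group. -/
def toGroup (G : Type*) [AddCommGroup G] [LinearOrder G] : BraidMonoid M G →* W :=
  PresentedMonoid.lift (fun p => cs.simple p.1) (by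
    intro x y h
    cases h with
    | comm i j a b hij => simpa using simple_mul_comm cs hij
    | braid i j a b c a' b' c' hij h => simpa using simple_braid cs hij)

theorem toGroup_letter (i : I) (a : G) : toGroup cs G (letter M i a) = cs.simple i := rfl

theorem length_toGroup_le (x : BraidMonoid M G) : cs.length (toGroup cs G x) ≤ len x := by
  induction x using letter_mul_induction with
  | one => simp
  | mul i a x ih =>
    rw [map_mul, toGroup_letter, len_mul, len_letter, ← cs.length_simple i]
    exact (cs.length_mul_le _ _).trans (by omega)

/-- An element of the braid monoid is reduced if its length is that of its image in the group. -/
def IsRed (x : BraidMonoid M G) : Prop := cs.length (toGroup cs G x) = len x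

theorem IsRed.tail {i : I} {a : G} {x : BraidMonoid M G} (h : IsRed cs (letter M i a * x)) :
    IsRed cs x := by
  have h₁ := length_toGroup_le cs x
  have h₂ := cs.length_mul_le (cs.simple i) (toGroup cs G x)
  rw [IsRed, map_mul, toGroup_letter, len_mul, len_letter] at h
  rw [cs.length_simple] at h₂
  rw [IsRed]
  omega

/-- A repeated $i$ would cancel in the group and lower the length by two. -/
theorem IsRed.not_hasHead {i : I} {a : G} {x : BraidMonoid M G}
    (h : IsRed cs (letter M i a * x)) : ¬ HasHead i x := by
  rintro ⟨b, y, rfl⟩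
  have h₁ := length_toGroup_le cs y
  simp only [IsRed, map_mul, toGroup_letter, len_mul, len_letter,
    cs.simple_mul_simple_cancel_left] at h
  omega

theorem toGroup_tropCls (L : List (I × Tropical G)) :
    toGroup cs G (tropCls M L) = cs.wordProd (L.map Prod.fst) := by
  rw [tropCls, CoxeterSystem.wordProd, map_list_prod, List.map_map, List.map_map]
  rfl

theorem len_tropCls (L : List (I × Tropical G)) : len (tropCls M L) = L.length := by
  induction L with
  | nil => rfl
  | cons p L ih => rw [tropCls_cons, len_mul, ih, len_letter, List.length_cons, add_comm]

theorem isRed_tropCls {w : W} {L : List (I × Tropical G)} (hL : L.map Prod.fst ∈ redWords cs w) :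
    IsRed cs (tropCls M L) := by
  rw [IsRed, toGroup_tropCls, len_tropCls, hL.1, ← hL.2, List.length_map]

variable [IsOrderedAddMonoid G]

/-- Along a reduced word no operator meets a head equal to its own letter, so no merging ever
occurs. -/
theorem demazureAction_mon (hM : IsSimplyLaced M) (L : List (I × Tropical G))
    (hL : IsRed cs (tropCls M L)) : demazureAction hM G (mon M L) 1 = tropCls M L := by
  induction L with
  | nil =>
    simp only [mon, tropCls, List.map_nil, List.prod_nil, map_one]
    rfl
  | cons p L ih =>
    obtain ⟨i, a⟩ := p
    rw [tropCls_cons] at hL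
    rw [mon_cons, demazureAction_gen_mul, ih (hL.tail cs), tropCls_cons,
      demazure_of_not_hasHead (hL.not_hasHead cs)]

/-- Reduced words have the same image in `𝔘` only if they are related by braid moves. -/
theorem tropCls_eq_of_mon_eq (hM : IsSimplyLaced M) {L L' : List (I × Tropical G)}
    (hL : IsRed cs (tropCls M L)) (hL' : IsRed cs (tropCls M L')) (h : mon M L = mon M L') :
    tropCls M L = tropCls M L' := by
  rw [← demazureAction_mon cs hM L hL, h, demazureAction_mon cs hM L' hL']

/-- The source of the well-definedness of $z_i$ (first exponent) and of $T_i(a)$ (remaining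
product): cancel $i$ in the braid monoid, then map back to $\mathfrak U$. -/
theorem mon_cons_eq_mon_cons (hM : IsSimplyLaced M) {i : I} {a b : Tropical G}
    {L L' : List (I × Tropical G)} (hL : IsRed cs (tropCls M ((i, a) :: L)))
    (hL' : IsRed cs (tropCls M ((i, b) :: L'))) (h : mon M ((i, a) :: L) = mon M ((i, b) :: L')) :
    a = b ∧ mon M L = mon M L' := by
  have h₁ := tropCls_eq_of_mon_eq cs hM hL hL' h
  rw [tropCls_cons, tropCls_cons] at h₁
  obtain ⟨h₂, h₃⟩ := letter_mul_cancel hM h₁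
  refine ⟨Tropical.untrop_injective h₂, ?_⟩
  rw [← toUMonoid_tropCls, h₃, toUMonoid_tropCls]

end Coxeter

/-! ### Lifting braid moves, square-free elements and Matsumoto's theorem -/

section

variable {I : Type*} {M : CoxeterMatrix I} {G : Type*} [AddCommGroup G] [LinearOrder G]

/-- No word representing `x` has two equal adjacent generators. -/
def NoSquare (x : BraidMonoid M G) : Prop :=
  ∀ (u : BraidMonoid M G) (k : I) (a b : G) (v : BraidMonoid M G),
    x ≠ u * (letter M k a * (letter M k b * v))

theorem NoSquare.tail {i : I} {a : G} {x : BraidMonoid M G} (h : NoSquare (letter M i a * x)) :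
    NoSquare x := by
  rintro u k b c v rfl
  exact h (letter M i a * u) k b c v (by rw [mul_assoc])

theorem NoSquare.not_hasHead {i : I} {a : G} {x : BraidMonoid M G}
    (h : NoSquare (letter M i a * x)) : ¬ HasHead i x := by
  rintro ⟨b, y, rfl⟩
  exact h 1 i a b y (by rw [one_mul])

theorem noSquare_one : NoSquare (1 : BraidMonoid M G) := by
  intro u k a b v h
  have := congrArg len h
  simp at this
  omega

open Classical in
/-- The operator that removes a head `i` of `x` if there is one and adds it otherwise. -/
noncomputable def flip (i : I) (x : BraidMonoid M G) : BraidMonoid M G :=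
  if h : ∃ p : G × BraidMonoid M G, x = letter M i p.1 * p.2
  then h.choose.2 else letter M i 0 * x

theorem flip_of_not_hasHead {i : I} {x : BraidMonoid M G} (h : ¬ HasHead i x) :
    flip i x = letter M i 0 * x :=
  dif_neg fun ⟨p, hp⟩ => h ⟨p.1, p.2, hp⟩

theorem letter_braid_of_subsingleton [Subsingleton G] {i j : I} (hij : M i j = 3) (a b c : G)
    (x : BraidMonoid M G) : letter M i a * (letter M j b * (letter M i c * x)) =
      letter M j a * (letter M i b * (letter M j c * x)) :=
  letter_braid hij ⟨Subsingleton.elim _ _, Subsingleton.elim _ _, Subsingleton.elim _ _⟩ x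

/-- Braid moves between undecorated words lift to decorated words. The decorations keep any
property that is preserved by the tropical braid transformation. -/
theorem exists_decoration {G₀ : Type*} [AddCommGroup G₀] [LinearOrder G₀]
    {P : G → Prop} (hP : ∀ a b c a' b' c', TropBraid a b c a' b' c' → P a → P b → P c →
      P a' ∧ P b' ∧ P c') {r r' : FreeMonoid (I × G₀)} (h : ConGen.Rel (BraidRel M G₀) r r') :
    (∀ L : FreeMonoid (I × G), L.toList.map Prod.fst = r.toList.map Prod.fst →
      ∃ L' : FreeMonoid (I × G), L'.toList.map Prod.fst = r'.toList.map Prod.fst ∧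
        cls M L = cls M L' ∧ ((∀ p ∈ L.toList, P p.2) → ∀ p ∈ L'.toList, P p.2)) ∧
    (∀ L : FreeMonoid (I × G), L.toList.map Prod.fst = r'.toList.map Prod.fst →
      ∃ L' : FreeMonoid (I × G), L'.toList.map Prod.fst = r.toList.map Prod.fst ∧
        cls M L = cls M L' ∧ ((∀ p ∈ L.toList, P p.2) → ∀ p ∈ L'.toList, P p.2)) := by
  have comm : ∀ {i j : I}, M i j = 2 → ∀ L : FreeMonoid (I × G),
      L.toList.map Prod.fst = [i, j] → ∃ L' : FreeMonoid (I × G),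
        L'.toList.map Prod.fst = [j, i] ∧ cls M L = cls M L' ∧
        ((∀ p ∈ L.toList, P p.2) → ∀ p ∈ L'.toList, P p.2) := by
    intro i j hij L hL
    obtain ⟨⟨i, a⟩, _, hL, rfl, h⟩ := List.map_eq_cons_iff.1 hL
    obtain ⟨⟨j, b⟩, _, rfl, rfl, h'⟩ := List.map_eq_cons_iff.1 h
    obtain rfl := List.map_eq_nil_iff.1 h'
    obtain rfl : L = FreeMonoid.of (i, a) * FreeMonoid.of (j, b) := hL
    refine ⟨FreeMonoid.of (j, b) * FreeMonoid.of (i, a), by simp,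
      cls_eq_of_rel (.comm i j a b hij), ?_⟩
    simp
    tauto
  have braid : ∀ {i j : I}, M i j = 3 → ∀ L : FreeMonoid (I × G),
      L.toList.map Prod.fst = [i, j, i] → ∃ L' : FreeMonoid (I × G),
        L'.toList.map Prod.fst = [j, i, j] ∧ cls M L = cls M L' ∧
        ((∀ p ∈ L.toList, P p.2) → ∀ p ∈ L'.toList, P p.2) := by
    intro i j hij L hL
    obtain ⟨⟨i, a⟩, _, hL, rfl, h⟩ := List.map_eq_cons_iff.1 hL
    obtain ⟨⟨j, b⟩, _, rfl, rfl, h'⟩ := List.map_eq_cons_iff.1 h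
    obtain ⟨⟨k, c⟩, _, rfl, hk, h''⟩ := List.map_eq_cons_iff.1 h'
    obtain rfl : k = i := hk
    obtain rfl := List.map_eq_nil_iff.1 h''
    obtain rfl : L = FreeMonoid.of (k, a) * FreeMonoid.of (j, b) * FreeMonoid.of (k, c) := hL
    obtain ⟨a', b', c', ht⟩ := TropBraid.exists_eq a b c
    refine ⟨FreeMonoid.of (j, a') * FreeMonoid.of (k, b') * FreeMonoid.of (j, c'), by simp,
      cls_eq_of_rel (.braid k j a b c a' b' c' hij ht), ?_⟩
    have := hP _ _ _ _ _ _ ht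
    simp
    tauto
  -- Both directions are carried along because the generated congruence is symmetric.
  induction h with
  | of r r' h =>
    cases h with
    | comm i j a b hij =>
      exact ⟨by simpa using comm hij, by simpa using comm (by rw [M.symmetric]; exact hij)⟩
    | braid i j a b c a' b' c' hij h =>
      exact ⟨by simpa using braid hij, by simpa using braid (by rw [M.symmetric]; exact hij)⟩
  | refl r => exact ⟨fun L hL => ⟨L, hL, rfl, id⟩, fun L hL => ⟨L, hL, rfl, id⟩⟩
  | symm _ ih => exact ih.symm
  | trans _ _ ih ih' =>
    constructor
    · intro L hL
      obtain ⟨L', hL', h, hn⟩ := ih.1 L hL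
      obtain ⟨L'', hL'', h', hn'⟩ := ih'.1 L' hL'
      exact ⟨L'', hL'', h.trans h', hn' ∘ hn⟩
    · intro L hL
      obtain ⟨L', hL', h, hn⟩ := ih'.2 L hL
      obtain ⟨L'', hL'', h', hn'⟩ := ih.2 L' hL'
      exact ⟨L'', hL'', h.trans h', hn' ∘ hn⟩
  | @mul r₁ r₁' r₂ r₂' _ _ ih₁ ih₂ =>
    have key : ∀ {r₁ r₂ r₁' r₂' : FreeMonoid (I × G₀)},
        (∀ L : FreeMonoid (I × G), L.toList.map Prod.fst = r₁.toList.map Prod.fst →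
          ∃ L' : FreeMonoid (I × G), L'.toList.map Prod.fst = r₁'.toList.map Prod.fst ∧
          cls M L = cls M L' ∧ ((∀ p ∈ L.toList, P p.2) → ∀ p ∈ L'.toList, P p.2)) →
        (∀ L : FreeMonoid (I × G), L.toList.map Prod.fst = r₂.toList.map Prod.fst →
          ∃ L' : FreeMonoid (I × G), L'.toList.map Prod.fst = r₂'.toList.map Prod.fst ∧
          cls M L = cls M L' ∧ ((∀ p ∈ L.toList, P p.2) → ∀ p ∈ L'.toList, P p.2)) →
        ∀ L : FreeMonoid (I × G), L.toList.map Prod.fst = (r₁ * r₂).toList.map Prod.fst →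
          ∃ L' : FreeMonoid (I × G), L'.toList.map Prod.fst = (r₁' * r₂').toList.map Prod.fst ∧
          cls M L = cls M L' ∧ ((∀ p ∈ L.toList, P p.2) → ∀ p ∈ L'.toList, P p.2) := by
      intro r₁ r₂ r₁' r₂' h₁ h₂ L hL
      rw [FreeMonoid.toList_mul, List.map_append] at hL
      obtain ⟨L₁, L₂, hL, hL₁, hL₂⟩ := List.map_eq_append_iff.1 hL
      obtain ⟨L₁', hL₁', e₁, hn₁⟩ := h₁ (FreeMonoid.ofList L₁) hL₁
      obtain ⟨L₂', hL₂', e₂, hn₂⟩ := h₂ (FreeMonoid.ofList L₂) hL₂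
      obtain rfl : L = FreeMonoid.ofList L₁ * FreeMonoid.ofList L₂ := hL
      refine ⟨L₁' * L₂', by simp [hL₁', hL₂'], by rw [map_mul, map_mul, e₁, e₂], ?_⟩
      intro h p hp
      simp only [FreeMonoid.toList_mul, FreeMonoid.toList_ofList, List.mem_append] at h hp hn₁ hn₂
      rcases hp with hp | hp
      · exact hn₁ (fun p hp => h p (Or.inl hp)) p hp
      · exact hn₂ (fun p hp => h p (Or.inr hp)) p hp
    exact ⟨key ih₁.1 ih₂.1, key ih₁.2 ih₂.2⟩

variable [IsOrderedAddMonoid G]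

theorem flip_letter_mul (hM : IsSimplyLaced M) (i : I) (b : G) (y : BraidMonoid M G) :
    flip i (letter M i b * y) = y := by
  have h : ∃ p : G × BraidMonoid M G, letter M i b * y = letter M i p.1 * p.2 := ⟨(b, y), rfl⟩
  obtain ⟨h₁, h₂⟩ := letter_mul_cancel hM h.choose_spec
  rw [flip, dif_pos h, ← h₂]

/-- The exchange property of the braid monoid. -/
theorem NoSquare.letter_mul (hM : IsSimplyLaced M) {i : I} (a : G) {x : BraidMonoid M G}
    (hx : NoSquare x) (hi : ¬ HasHead i x) : NoSquare (letter M i a * x) := by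
  induction hn : len x using Nat.strong_induction_on generalizing i a x with
  | h n ih =>
  intro u k b c v h
  induction u using letter_mul_induction with
  | one =>
    -- The square stands at the very front. A common multiple of $i$ and $k$ then puts a square $kk$
    -- or $ii$ into $x$, or makes $i$ a head of $x$.
    rw [one_mul] at h
    obtain ⟨rfl, -, rfl⟩ | ⟨hik, z, rfl, hz⟩ | ⟨hik, p, q, p', q', z, -, rfl, hz⟩ :=
      headRel_of_eq hM h
    · exact hi (hasHead_letter_mul _ _ _)
    · obtain ⟨w, -, rfl⟩ := exists_of_comm hM (by rw [M.symmetric]; exact hik) hz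
      exact hx 1 k _ _ w (by rw [one_mul])
    · obtain ⟨_, _, _, _, w, -, -, hw⟩ := exists_of_braid hM (by rw [M.symmetric]; exact hik) hz
      obtain ⟨-, rfl⟩ := letter_mul_cancel hM hw
      exact hx _ i _ _ w rfl
  | mul j d u _ =>
    rw [mul_assoc] at h
    obtain ⟨rfl, -, rfl⟩ | ⟨hij, z, rfl, hz⟩ | ⟨hij, p, q, p', q', z, -, rfl, hz⟩ :=
      headRel_of_eq hM h
    · exact hx u k b c v rfl
    · have hz' : ¬ HasHead i z := by
        rintro ⟨e, w, rfl⟩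
        exact hi ⟨_, _, letter_comm (by rw [M.symmetric]; exact hij) _ _ _⟩
      exact ih (len z) (by rw [len_mul, len_letter] at hn; omega) a hx.tail hz' rfl u k b c v hz.symm
    -- Now $x=j^p\,i^q\,z$ and the square lies in $i^{p'}j^{q'}z$. Two uses of the induction
    -- hypothesis, first for $j^{q'}z$, show that this element is square-free.
    · have hji : M j i = 3 := by rw [M.symmetric]; exact hij
      have hj : ¬ HasHead j z := by
        rintro ⟨e, w, rfl⟩
        obtain ⟨_, _, _, ht⟩ := TropBraid.exists_eq p q e
        exact hi ⟨_, _, letter_braid hji ht _⟩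
      simp only [len_mul, len_letter] at hn
      have hz₁ := ih (len z) (by omega) q' hx.tail.tail hj rfl
      exact ih _ (by simp only [len_mul, len_letter]; omega) p' hz₁
        (fun h => hx.tail.not_hasHead (h.of_letter_mul_of_braid hM hji)) rfl u k b c v hz.symm

theorem NoSquare.flip (hM : IsSimplyLaced M) (i : I) {x : BraidMonoid M G} (hx : NoSquare x) :
    NoSquare (flip i x) := by
  by_cases h : HasHead i x
  · obtain ⟨a, y, rfl⟩ := h
    rw [flip_letter_mul hM]
    exact hx.tail
  · rw [flip_of_not_hasHead h]
    exact hx.letter_mul hM _ h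

theorem flip_comm (hM : IsSimplyLaced M) {i j : I} (hij : M i j = 2) {x : BraidMonoid M G}
    (hx : NoSquare x) : flip i (flip j x) = flip j (flip i x) := by
  have hji : M j i = 2 := by rw [M.symmetric]; exact hij
  have key : ∀ {i j : I}, M i j = 2 → ¬ HasHead i x → flip i (flip j x) = flip j (flip i x) := by
    intro i j hij hi
    have hji : M j i = 2 := by rw [M.symmetric]; exact hij
    rw [flip_of_not_hasHead hi]
    by_cases hj : HasHead j x
    · obtain ⟨c, y, rfl⟩ := hj
      have hy : ¬ HasHead i y := by
        rintro ⟨d, z, rfl⟩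
        exact hi ⟨_, _, letter_comm hji _ _ _⟩
      rw [flip_letter_mul hM, flip_of_not_hasHead hy, letter_comm hij, flip_letter_mul hM]
    · rw [flip_of_not_hasHead hj,
        flip_of_not_hasHead fun h => hi (h.of_letter_mul_of_comm hM hji),
        flip_of_not_hasHead fun h => hj (h.of_letter_mul_of_comm hM hij), letter_comm hij]
  by_cases hi : HasHead i x
  · by_cases hj : HasHead j x
    · obtain ⟨c, y, rfl⟩ := hi
      obtain ⟨d, y', h⟩ := hj
      obtain ⟨z, rfl, -⟩ := exists_of_comm hM hij h
      rw [flip_letter_mul hM, flip_letter_mul hM, letter_comm hij, flip_letter_mul hM,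
        flip_letter_mul hM]
    · exact (key hji hj).symm
  · exact key hij hi

section Undecorated

variable [Subsingleton G]

theorem flip_flip (hM : IsSimplyLaced M) (i : I) {x : BraidMonoid M G} (hx : NoSquare x) :
    flip i (flip i x) = x := by
  by_cases h : HasHead i x
  · obtain ⟨a, y, rfl⟩ := h
    rw [flip_letter_mul hM, flip_of_not_hasHead hx.not_hasHead, Subsingleton.elim a 0]
  · rw [flip_of_not_hasHead h, flip_letter_mul hM]

theorem flip_braid_of_rankTwo (hM : IsSimplyLaced M) {i j : I} (hij : M i j = 3)
    {x : BraidMonoid M G} (hx : NoSquare x) (h : RankTwo i j x) :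
    flip i (flip j (flip i x)) = flip j (flip i (flip j x)) := by
  have hji : M j i = 3 := by rw [M.symmetric]; exact hij
  cases h with
  | none hi hj =>
    rw [flip_of_not_hasHead hi, flip_of_not_hasHead fun h => hj (h.of_letter_mul_of_braid hM hij),
      flip_of_not_hasHead fun h => hj (h.of_letter_mul_letter_mul hM hij),
      flip_of_not_hasHead hj, flip_of_not_hasHead fun h => hi (h.of_letter_mul_of_braid hM hji),
      flip_of_not_hasHead fun h => hi (h.of_letter_mul_letter_mul hM hji),
      letter_braid_of_subsingleton hij]
  | one d y h hi hy =>
    subst h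
    rw [flip_of_not_hasHead hi,
      flip_of_not_hasHead fun h => hy (h.of_letter_mul_letter_mul hM hji),
      letter_braid_of_subsingleton hji, flip_letter_mul hM, flip_letter_mul hM,
      flip_of_not_hasHead hy,
      flip_of_not_hasHead fun h => hx.not_hasHead (h.of_letter_mul_of_braid hM hij),
      Subsingleton.elim d 0]
  | two d e y h hi hy =>
    subst h
    rw [flip_of_not_hasHead hi, letter_braid_of_subsingleton hij, flip_letter_mul hM,
      flip_letter_mul hM, flip_letter_mul hM, flip_letter_mul hM, flip_of_not_hasHead hy,
      Subsingleton.elim e 0]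
  | three d e f y h =>
    subst h
    rw [flip_letter_mul hM, flip_letter_mul hM, flip_letter_mul hM,
      letter_braid_of_subsingleton hij, flip_letter_mul hM, flip_letter_mul hM,
      flip_letter_mul hM]

theorem flip_braid (hM : IsSimplyLaced M) {i j : I} (hij : M i j = 3) {x : BraidMonoid M G}
    (hx : NoSquare x) : flip i (flip j (flip i x)) = flip j (flip i (flip j x)) := by
  rcases rankTwo_or hM hij x with h | h
  · exact flip_braid_of_rankTwo hM hij hx h
  · exact (flip_braid_of_rankTwo hM (by rw [M.symmetric]; exact hij) hx h).symm

/-- The operator `flip` on the square-free elements. -/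
noncomputable def flipEnd (hM : IsSimplyLaced M) (G : Type*) [AddCommGroup G] [LinearOrder G]
    [IsOrderedAddMonoid G] (i : I) : Function.End {x : BraidMonoid M G // NoSquare x} :=
  fun x => ⟨flip i x.1, x.2.flip hM i⟩

/-- The Coxeter relations follow formally from the flips being involutions that commute or satisfy
the braid relation. -/
theorem isLiftable_flipEnd (hM : IsSimplyLaced M) : M.IsLiftable (flipEnd hM G) := by
  have hsq : ∀ i, flipEnd hM G i * flipEnd hM G i = 1 := fun i =>
    funext fun x => Subtype.ext (flip_flip hM i x.2)
  intro i j
  by_cases hij : i = j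
  · subst hij
    rw [M.diagonal, pow_one, hsq]
  rcases hM i j hij with h | h
  · have hc : flipEnd hM G i * flipEnd hM G j = flipEnd hM G j * flipEnd hM G i :=
      funext fun x => Subtype.ext (flip_comm hM h x.2)
    rw [h, pow_two]
    nth_rw 2 [hc]
    rw [mul_assoc, ← mul_assoc (flipEnd hM G j), hsq, one_mul, hsq]
  · have hb : flipEnd hM G i * (flipEnd hM G j * flipEnd hM G i) =
        flipEnd hM G j * (flipEnd hM G i * flipEnd hM G j) :=
      funext fun x => Subtype.ext (flip_braid hM h x.2)
    rw [h, pow_succ, pow_two]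
    simp only [mul_assoc]
    rw [← hb, ← mul_assoc (flipEnd hM G i) (flipEnd hM G i), hsq, one_mul,
      ← mul_assoc (flipEnd hM G j) (flipEnd hM G j), hsq, one_mul, hsq]

variable {W : Type*} [Group W] (cs : CoxeterSystem M W)

/-- The action of the Coxeter group on the square-free elements of the undecorated braid monoid. -/
noncomputable def flipAction (hM : IsSimplyLaced M) (G : Type*) [AddCommGroup G] [LinearOrder G]
    [IsOrderedAddMonoid G] [Subsingleton G] :
    W →* Function.End {x : BraidMonoid M G // NoSquare x} :=
  cs.lift ⟨flipEnd hM G, isLiftable_flipEnd hM⟩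

/-- Along a reduced word every flip adds its letter, so the image in $W$ determines a reduced
element. -/
theorem flipAction_toGroup (hM : IsSimplyLaced M) (x : BraidMonoid M G) (hx : IsRed cs x) :
    (flipAction cs hM G (toGroup cs G x) ⟨1, noSquare_one⟩).1 = x := by
  induction x using letter_mul_induction with
  | one => rw [map_one, map_one]; rfl
  | mul i a x ih =>
    have h : flipAction cs hM G (cs.simple i) = flipEnd hM G i :=
      cs.lift_apply_simple (isLiftable_flipEnd hM) i
    have h₁ : (flipAction cs hM G (toGroup cs G (letter M i a * x)) ⟨1, noSquare_one⟩).1 =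
        flip i (flipAction cs hM G (toGroup cs G x) ⟨1, noSquare_one⟩).1 := by
      rw [map_mul, map_mul, toGroup_letter, h]
      rfl
    rw [h₁, ih (hx.tail cs), flip_of_not_hasHead (hx.not_hasHead cs), Subsingleton.elim a 0]

/-- Matsumoto's theorem: reduced words of the same element are related by braid moves. -/
theorem eq_of_toGroup_eq (hM : IsSimplyLaced M) {x y : BraidMonoid M G} (hx : IsRed cs x)
    (hy : IsRed cs y) (h : toGroup cs G x = toGroup cs G y) : x = y := by
  rw [← flipAction_toGroup cs hM x hx, ← flipAction_toGroup cs hM y hy, h]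

end Undecorated

end

/-! ### Change of reduced word and absorption by the element with zero exponents -/

section

variable {I : Type*} {M : CoxeterMatrix I}

theorem gen_mul_gen {S : Type*} [Mul S] [Add S] (i : I) (a b : S) :
    gen M i a * gen M i b = gen M i (a + b) :=
  PresentedMonoid.mk_eq_mk_of_rel (Rel.merge i a b)

theorem mon_append {S : Type*} [Mul S] [Add S] (L L' : List (I × S)) :
    mon M (L ++ L') = mon M L * mon M L' := by
  simp [mon]

/-- The element `i₁^0 ⋯ i_n^0`. -/
def unitMon (M : CoxeterMatrix I) (S : Type*) [Mul S] [Add S] [One S] (r : List I) : UMonoid M S :=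
  mon M (r.map fun i => (i, 1))

theorem unitMon_append {S : Type*} [Mul S] [Add S] [One S] (r r' : List I) :
    unitMon M S (r ++ r') = unitMon M S r * unitMon M S r' := by
  rw [unitMon, List.map_append, mon_append]
  rfl

theorem unitMon_singleton {S : Type*} [Mul S] [Add S] [One S] (i : I) :
    unitMon M S [i] = gen M i 1 := by
  simp [unitMon, mon]

theorem unitMon_cons {S : Type*} [Mul S] [Add S] [One S] (i : I) (r : List I) :
    unitMon M S (i :: r) = gen M i 1 * unitMon M S r := by
  rw [← unitMon_singleton, ← unitMon_append, List.singleton_append]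

variable {W : Type*} [Group W] (cs : CoxeterSystem M W)

theorem tropCls_eq_cls {G : Type*} [AddCommGroup G] [LinearOrder G] (L : List (I × Tropical G)) :
    tropCls M L = cls M (FreeMonoid.ofList (L.map fun p => (p.1, p.2.untrop))) := by
  induction L with
  | nil => rfl
  | cons p L ih => rw [tropCls_cons, ih, List.map_cons, FreeMonoid.ofList_cons, map_mul]; rfl

section

variable {G : Type*} [AddCommGroup G] [LinearOrder G]

/-- An element written in terms of one reduced word can be written in terms of any other. -/
theorem exists_mon_eq (hM : IsSimplyLaced M) {P : G → Prop}
    (hP : ∀ a b c a' b' c', TropBraid a b c a' b' c' → P a → P b → P c → P a' ∧ P b' ∧ P c')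
    {w : W} {L : List (I × Tropical G)} (hL : L.map Prod.fst ∈ redWords cs w) {r : List I}
    (hr : r ∈ redWords cs w) : ∃ L' : List (I × Tropical G), L'.map Prod.fst = r ∧
      mon M L = mon M L' ∧ ((∀ p ∈ L, P p.2.untrop) → ∀ p ∈ L', P p.2.untrop) := by
  -- The zero subgroup of $\mathbb Z$ serves as a trivial ordered group: words decorated by it are
  -- bare words, to which Matsumoto's theorem applies.
  let f : List I → List (I × Tropical (⊥ : AddSubgroup ℤ)) := fun r => r.map fun i => (i, 1)
  have hf : ∀ r, (f r).map Prod.fst = r := fun r => by simp [f, Function.comp_def]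
  have h : tropCls M (f (L.map Prod.fst)) = tropCls M (f r) := by
    refine eq_of_toGroup_eq cs hM (isRed_tropCls cs (w := w) (by rwa [hf]))
      (isRed_tropCls cs (w := w) (by rwa [hf])) ?_
    rw [toGroup_tropCls, toGroup_tropCls, hf, hf, hL.1, hr.1]
  rw [tropCls_eq_cls, tropCls_eq_cls] at h
  have hrel : ConGen.Rel (BraidRel M (⊥ : AddSubgroup ℤ)) _ _ := (Con.eq _).1 h
  obtain ⟨L', hL', heq, hn⟩ := (exists_decoration hP hrel).1
    (FreeMonoid.ofList (L.map fun p => (p.1, p.2.untrop)))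
    (by simp [f, Function.comp_def])
  refine ⟨L'.toList.map fun p => (p.1, Tropical.trop p.2), ?_, ?_, ?_⟩
  · rw [List.map_map]
    refine Eq.trans hL' ?_
    simp [f, Function.comp_def]
  · rw [← toUMonoid_tropCls, tropCls_eq_cls, heq, ← toUMonoid_tropCls, tropCls_eq_cls, List.map_map]
    congr 2
    exact (List.map_id L'.toList).symm
  · intro h p hp
    obtain ⟨q, hq, rfl⟩ := List.mem_map.1 hp
    refine hn ?_ q hq
    intro p' hp'
    obtain ⟨q', hq', rfl⟩ := List.mem_map.1 hp'
    exact h q' hq'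

/-- Having all exponents zero is preserved by the tropical braid transformation. -/
theorem unitMon_eq (hM : IsSimplyLaced M) {w : W} {r r' : List I} (hr : r ∈ redWords cs w)
    (hr' : r' ∈ redWords cs w) : unitMon M (Tropical G) r = unitMon M (Tropical G) r' := by
  have hP : ∀ a b c a' b' c' : G, TropBraid a b c a' b' c' → a = 0 → b = 0 → c = 0 →
      a' = 0 ∧ b' = 0 ∧ c' = 0 := by
    rintro a b c a' b' c' ⟨h1, h2, h3⟩ rfl rfl rfl
    rw [min_self] at h1
    subst h1
    simp_all
  obtain ⟨L', hL', h, h0⟩ := exists_mon_eq cs hM hP (L := r.map fun i => (i, (1 : Tropical G)))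
    (by simpa [Function.comp_def] using hr) hr'
  have h1 : ∀ p ∈ L', p.2.untrop = (0 : G) := h0 fun p hp => by
    obtain ⟨i, -, rfl⟩ := List.mem_map.1 hp
    rfl
  rw [unitMon, h, unitMon, ← hL', List.map_map]
  congr 1
  refine (List.map_id L').symm.trans (List.map_congr_left fun p hp => ?_)
  exact Prod.ext rfl (Tropical.untrop_injective (h1 p hp))

end

theorem exists_redWord (w : W) : ∃ r, r ∈ redWords cs w := by
  obtain ⟨r, hr, rfl⟩ := cs.exists_isReduced w
  exact ⟨r, rfl, hr.symm⟩

theorem reverse_mem_redWords {w : W} {r : List I} (hr : r ∈ redWords cs w) :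
    r.reverse ∈ redWords cs w⁻¹ := by
  refine ⟨?_, ?_⟩
  · rw [cs.wordProd_reverse, hr.1]
  · rw [List.length_reverse, hr.2, cs.length_inv]

/-- By maximality $s_iw$ is shorter than $w$, so $i$ can be put before any reduced word of $s_iw$.
-/
theorem exists_cons_mem_redWords {w : W} (hw : ∀ x, cs.length x ≤ cs.length w) (i : I) :
    ∃ r, i :: r ∈ redWords cs w := by
  obtain ⟨r, hr⟩ := exists_redWord cs (cs.simple i * w)
  refine ⟨r, ?_, ?_⟩
  · rw [cs.wordProd_cons, hr.1, cs.simple_mul_simple_cancel_left]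
  · have h₁ := hw (cs.simple i * w)
    have h₂ := cs.length_simple_mul w i
    rw [List.length_cons, hr.2]
    omega

theorem exists_append_mem_redWords {w : W} (hw : ∀ x, cs.length x ≤ cs.length w) (i : I) :
    ∃ r, r ++ [i] ∈ redWords cs w := by
  obtain ⟨r, hr⟩ := exists_cons_mem_redWords cs (w := w⁻¹) (by simpa using hw) i
  exact ⟨r.reverse, by simpa using reverse_mem_redWords cs hr⟩

theorem one_add_eq_one {G : Type*} [AddCommGroup G] [LinearOrder G]
    {a : Tropical G} (ha : 0 ≤ a.untrop) : 1 + a = 1 :=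
  Tropical.untrop_injective (min_eq_left ha)

section

variable {G : Type*} [AddCommGroup G] [LinearOrder G]

/-- For each letter $i^a$ choose a reduced word ending in $i$; then $i^0i^a=i^0$ absorbs it. -/
theorem unitMon_mul_mon (hM : IsSimplyLaced M) {w : W} (hw : ∀ x, cs.length x ≤ cs.length w)
    {r : List I} (hr : r ∈ redWords cs w) (L : List (I × Tropical G))
    (hL : ∀ p ∈ L, 0 ≤ p.2.untrop) :
    unitMon M (Tropical G) r * mon M L = unitMon M (Tropical G) r := by
  induction L with
  | nil => simp [mon]
  | cons p L ih =>
    obtain ⟨i, a⟩ := p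
    obtain ⟨r', hr'⟩ := exists_append_mem_redWords cs hw i
    have h : unitMon M (Tropical G) r * gen M i a = unitMon M (Tropical G) r := by
      rw [unitMon_eq cs hM hr hr', unitMon_append, unitMon_singleton, mul_assoc, gen_mul_gen,
        one_add_eq_one (hL (i, a) List.mem_cons_self)]
    rw [mon_cons, ← mul_assoc, h, ih fun p hp => hL p (List.mem_cons_of_mem _ hp)]

theorem unitMon_mul_unitMon (hM : IsSimplyLaced M) {w : W} (hw : ∀ x, cs.length x ≤ cs.length w)
    {r : List I} (hr : r ∈ redWords cs w) (l : List I) :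
    unitMon M (Tropical G) l * unitMon M (Tropical G) r = unitMon M (Tropical G) r := by
  induction l with
  | nil => simp [unitMon, mon]
  | cons i l ih =>
    obtain ⟨r', hr'⟩ := exists_cons_mem_redWords cs hw i
    rw [unitMon_cons, mul_assoc, ih, unitMon_eq cs hM hr hr', unitMon_cons, ← mul_assoc, gen_mul_gen,
      one_add_eq_one le_rfl]

/-- The product of the elements of $r$ and of its reverse equals either factor, by absorption on the
two sides. That $w_0$ is an involution is not needed. -/
theorem unitMon_reverse (hM : IsSimplyLaced M) {w : W} (hw : ∀ x, cs.length x ≤ cs.length w)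
    {r : List I} (hr : r ∈ redWords cs w) :
    unitMon M (Tropical G) r.reverse = unitMon M (Tropical G) r := by
  have h₁ := unitMon_mul_unitMon (G := G) cs hM (w := w⁻¹) (by simpa using hw)
    (reverse_mem_redWords cs hr) r
  rw [← h₁]
  refine unitMon_mul_mon cs hM hw hr _ fun p hp => ?_
  obtain ⟨i, -, rfl⟩ := List.mem_map.1 hp
  exact le_rfl

variable [IsOrderedAddMonoid G] [Finite W]

theorem length_le_longest (x : W) : cs.length x ≤ cs.length (longest cs) :=
  Classical.choose_spec (Finite.exists_max cs.length) x

theorem T_mk (hM : IsSimplyLaced M) (i : I) (a a₁ : Tropical G) (L : List (I × Tropical G))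
    (hL : i :: L.map Prod.fst ∈ redWords cs (longest cs)) :
    T cs i a (U.mk cs ((i, a₁) :: L) hL) = U.mk cs ((i, a₁ * a) :: L) hL := by
  have h : ∃ p : Tropical G × List (I × Tropical G),
      ∃ hp : ((i, p.1) :: p.2).map Prod.fst ∈ redWords cs (longest cs),
        U.mk cs ((i, p.1) :: p.2) hp = U.mk cs ((i, a₁) :: L) hL := ⟨(a₁, L), hL, rfl⟩
  obtain ⟨h₁, h₂⟩ := mon_cons_eq_mon_cons cs hM (isRed_tropCls cs h.choose_spec.choose)
    (isRed_tropCls cs hL) (congrArg Subtype.val h.choose_spec.choose_spec)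
  rw [T, dif_pos h]
  refine Subtype.ext ?_
  change mon M ((i, h.choose.1 * a) :: h.choose.2) = mon M ((i, a₁ * a) :: L)
  rw [mon_cons, mon_cons, h₁, h₂]

theorem z_mk (hM : IsSimplyLaced M) (i : I) (a₁ : Tropical G) (L : List (I × Tropical G))
    (hL : i :: L.map Prod.fst ∈ redWords cs (longest cs)) :
    z cs i (U.mk cs ((i, a₁) :: L) hL) = a₁ := by
  have h : ∃ p : Tropical G × List (I × Tropical G),
      ∃ hp : ((i, p.1) :: p.2).map Prod.fst ∈ redWords cs (longest cs),
        U.mk cs ((i, p.1) :: p.2) hp = U.mk cs ((i, a₁) :: L) hL := ⟨(a₁, L), hL, rfl⟩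
  obtain ⟨h₁, -⟩ := mon_cons_eq_mon_cons cs hM (isRed_tropCls cs h.choose_spec.choose)
    (isRed_tropCls cs hL) (congrArg Subtype.val h.choose_spec.choose_spec)
  rw [z, dif_pos h, h₁]

end

/-! ### The algorithm on $\mathcal U(K_+)$ -/

variable [Finite W] {K : AddSubgroup ℝ}

/-- Every element of `𝒰(K₊)` can be written with a reduced word that starts with `i`. -/
theorem exists_cons_of_mem_Uplus (hM : IsSimplyLaced M) (i : I) {H : U cs (Trop K)}
    (hH : H ∈ Uplus cs K) : ∃ (a : Trop K) (L : List (I × Trop K))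
      (hL : i :: L.map Prod.fst ∈ redWords cs (longest cs)), a ∈ nonneg K ∧
      (∀ p ∈ L, p.2 ∈ nonneg K) ∧ H = U.mk cs ((i, a) :: L) hL := by
  obtain ⟨L, hL, hn, rfl⟩ := hH
  obtain ⟨r, hr⟩ := exists_cons_mem_redWords cs (length_le_longest cs) i
  obtain ⟨L', hL', h, hn'⟩ := exists_mon_eq cs hM (P := fun a : K => 0 ≤ a)
    (fun a b c a' b' c' h => h.nonneg) hL hr
  obtain ⟨⟨i, a⟩, L', rfl, rfl, rfl⟩ := List.map_eq_cons_iff.1 hL'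
  have hn'' := List.forall_mem_cons.1 (hn' hn)
  exact ⟨a, L', hr, hn''.1, hn''.2, Subtype.ext h⟩

theorem z_mem_nonneg (hM : IsSimplyLaced M) (i : I) {H : U cs (Trop K)} (hH : H ∈ Uplus cs K) :
    z cs i H ∈ nonneg K := by
  obtain ⟨a, L, hL, ha, -, rfl⟩ := exists_cons_of_mem_Uplus cs hM i hH
  rwa [z_mk cs hM]

theorem T_inv_z_mem_Uplus (hM : IsSimplyLaced M) (i : I) {H : U cs (Trop K)}
    (hH : H ∈ Uplus cs K) : T cs i (z cs i H)⁻¹ H ∈ Uplus cs K := by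
  obtain ⟨a, L, hL, ha, hn, rfl⟩ := exists_cons_of_mem_Uplus cs hM i hH
  rw [z_mk cs hM, T_mk cs hM, mul_inv_cancel]
  exact ⟨(i, 1) :: L, hL, List.forall_mem_cons.2 ⟨le_refl (0 : ℝ), hn⟩, rfl⟩

/-- Turns a step of the algorithm into a multiplication in $\mathfrak U(K)$: for $a\ge 0$, $i^0\cdot
i^a=i^0$. -/
theorem T_inv_z_val (hM : IsSimplyLaced M) (i : I) {H : U cs (Trop K)} (hH : H ∈ Uplus cs K) :
    (T cs i (z cs i H)⁻¹ H).1 = gen M i 1 * H.1 := by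
  obtain ⟨a, L, hL, ha, hn, rfl⟩ := exists_cons_of_mem_Uplus cs hM i hH
  rw [z_mk cs hM, T_mk cs hM, mul_inv_cancel]
  simp only [U.mk, mon_cons]
  rw [← mul_assoc, gen_mul_gen, one_add_eq_one ha]

theorem T_z_T_inv_z (hM : IsSimplyLaced M) (i : I) {H : U cs (Trop K)} (hH : H ∈ Uplus cs K) :
    T cs i (z cs i H) (T cs i (z cs i H)⁻¹ H) = H := by
  obtain ⟨a, L, hL, ha, hn, rfl⟩ := exists_cons_of_mem_Uplus cs hM i hH
  rw [z_mk cs hM, T_mk cs hM, T_mk cs hM, inv_mul_cancel_right]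

theorem foldl_mem_Uplus (hM : IsSimplyLaced M) (l : List I) {H : U cs (Trop K)}
    (hH : H ∈ Uplus cs K) :
    l.foldl (fun H i => T cs i (z cs i H)⁻¹ H) H ∈ Uplus cs K := by
  induction l generalizing H with
  | nil => exact hH
  | cons i l ih => exact ih (T_inv_z_mem_Uplus cs hM i hH)

/-- Later steps multiply further to the left, hence the reversed word. -/
theorem foldl_val (hM : IsSimplyLaced M) (l : List I) {H : U cs (Trop K)} (hH : H ∈ Uplus cs K) :
    (l.foldl (fun H i => T cs i (z cs i H)⁻¹ H) H).1 = unitMon M (Trop K) l.reverse * H.1 := by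
  induction l generalizing H with
  | nil => simp [unitMon, mon]
  | cons i l ih =>
    rw [List.foldl_cons, ih (T_inv_z_mem_Uplus cs hM i hH), T_inv_z_val cs hM i hH,
      List.reverse_cons, unitMon_append, unitMon_singleton, mul_assoc]

theorem state_mem_Uplus (hM : IsSimplyLaced M) (ii : List I) {H : U cs (Trop K)}
    (hH : H ∈ Uplus cs K) (j : ℕ) : state cs K ii H j ∈ Uplus cs K :=
  foldl_mem_Uplus cs hM _ hH

/-- The reversed word also gives $\mathbf H$, which absorbs the nonnegative word of $H_1$; so the
algorithm always ends in the same state. -/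
theorem state_length (hM : IsSimplyLaced M) {ii : List I} (hii : ii ∈ redWords cs (longest cs))
    {H : U cs (Trop K)} (hH : H ∈ Uplus cs K) : state cs K ii H ii.length = HH cs K ii hii := by
  refine Subtype.ext ?_
  rw [state, List.take_length, foldl_val cs hM _ hH, unitMon_reverse cs hM (length_le_longest cs) hii]
  obtain ⟨L, hL, hn, rfl⟩ := hH
  exact unitMon_mul_mon cs hM (length_le_longest cs) hii L hn

/-- Each step is undone by $T_{i_j}(c_j)$. The induction runs over arbitrary words, since the tail
of a reduced word of $w_0$ is no longer one. -/
theorem applyT_coeff_state (hM : IsSimplyLaced M) (ii : List I) {H : U cs (Trop K)}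
    (hH : H ∈ Uplus cs K) :
    applyT cs K ii (coeff cs K ii H) (state cs K ii H ii.length) = H := by
  induction ii generalizing H with
  | nil => rfl
  | cons i ii ih =>
    have h := ih (T_inv_z_mem_Uplus cs hM i hH)
    have h₁ : applyT cs K (i :: ii) (coeff cs K (i :: ii) H)
        (state cs K (i :: ii) H (i :: ii).length) = T cs i (z cs i H)
          (applyT cs K ii (coeff cs K ii (T cs i (z cs i H)⁻¹ H))
            (state cs K ii (T cs i (z cs i H)⁻¹ H) ii.length)) := by
      refine (congrArg (List.foldr (fun (j : Fin (i :: ii).length) X =>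
        T cs (i :: ii)[j] (coeff cs K (i :: ii) H j) X) (state cs K (i :: ii) H (i :: ii).length))
        List.finRange_succ).trans ?_
      rw [List.foldr_cons, List.foldr_map]
      rfl
    rw [h₁, h, T_z_T_inv_z cs hM i hH]

theorem eq_applyT_coeff (hM : IsSimplyLaced M) {ii : List I} (hii : ii ∈ redWords cs (longest cs))
    {H : U cs (Trop K)} (hH : H ∈ Uplus cs K) :
    H = applyT cs K ii (coeff cs K ii H) (HH cs K ii hii) := by
  rw [← state_length cs hM hii hH, applyT_coeff_state cs hM ii hH]

end

end HalfCircle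

/-! ### The main theorem -/

theorem theorem13 {I W : Type*} [Nonempty I] [Group W] [Finite W] {M : CoxeterMatrix I}
    (cs : CoxeterSystem M W) (hM : HalfCircle.IsSimplyLaced M)
    (K : AddSubgroup ℝ) (hK : K ≠ ⊥)
    (ii : List I) (hii : ii ∈ HalfCircle.redWords cs (HalfCircle.longest cs)) :
    -- the maps `T_i(a)` are well defined
    (∀ (i : I) (a a₁ : HalfCircle.Trop K) (L : List (I × HalfCircle.Trop K))
      (hL : i :: L.map Prod.fst ∈ HalfCircle.redWords cs (HalfCircle.longest cs)),
      HalfCircle.T cs i a (HalfCircle.U.mk cs ((i, a₁) :: L) hL) =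
        HalfCircle.U.mk cs ((i, a₁ * a) :: L) hL) ∧
    -- the maps `z_i` are well defined
    (∀ (i : I) (a₁ : HalfCircle.Trop K) (L : List (I × HalfCircle.Trop K))
      (hL : i :: L.map Prod.fst ∈ HalfCircle.redWords cs (HalfCircle.longest cs)),
      HalfCircle.z cs i (HalfCircle.U.mk cs ((i, a₁) :: L) hL) = a₁) ∧
    -- the algorithm stays in `𝒰(K₊)`, has outputs in `K₊`, and recovers `H₁`
    (∀ H₁ ∈ HalfCircle.Uplus cs K,
      (∀ j ≤ ii.length, HalfCircle.state cs K ii H₁ j ∈ HalfCircle.Uplus cs K) ∧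
      (∀ j, HalfCircle.coeff cs K ii H₁ j ∈ HalfCircle.nonneg K) ∧
      H₁ = HalfCircle.applyT cs K ii (HalfCircle.coeff cs K ii H₁)
        (HalfCircle.HH cs K ii hii)) ∧
    -- the map `H₁ ↦ (c₁, …, c_ν)` is injective on `𝒰(K₊)`
    Set.InjOn (fun H₁ => HalfCircle.coeff cs K ii H₁) (HalfCircle.Uplus cs K) := by
  refine ⟨HalfCircle.T_mk cs hM, HalfCircle.z_mk cs hM, fun H₁ hH => ⟨fun j _ =>
    HalfCircle.state_mem_Uplus cs hM ii hH j, fun j =>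
    HalfCircle.z_mem_nonneg cs hM _ (HalfCircle.state_mem_Uplus cs hM ii hH j),
    HalfCircle.eq_applyT_coeff cs hM hii hH⟩, fun H hH H' hH' h => ?_⟩
  have h' : HalfCircle.coeff cs K ii H = HalfCircle.coeff cs K ii H' := h
  -- The reconstruction formula starts from $\mathbf H$, which does not depend on $H_1$, so the
  -- coefficients determine $H_1$.
  rw [HalfCircle.eq_applyT_coeff cs hM hii hH, h', ← HalfCircle.eq_applyT_coeff cs hM hii hH']
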